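/- Let $V$ be an infinite countable set and let $b:V\times V\to[0,\infty)$ satisfy $b(x,x)=0$, $b(x,y)=b(y,x)$ and $\sum_{y}b(x,y)<\infty$ for all $x,y\in V$; assume that the weighted graph $(b,0)$ is connected, i.e. any two vertices are joined by a finite path of edges of positive weight. Let $$\widetilde D=\Big\{u:V\to\mathbb R \,:\, \sum_{x,y}b(x,y)(u(x)-u(y))^2<\infty\Big\},\qquad \widetilde Q(u,v)=\tfrac12\sum_{x,y}b(x,y)(u(x)-u(y))(v(x)-v(y))\quad(u,v\in\widetilde D).$$ A measure of full support is a function $m:V\to(0,\infty)$; it is finite if $\sum_x m(x)<\infty$. For such $m$ let $Q^D_m$ be the restriction of $\widetilde Q$ to the closure of the finitely supported functions in $\widetilde D\cap\ell^2(V,m)$ with respect to the norm $(\widetilde Q(u,u)+\|u\|^2_{\ell^2(V,m)})^{1/2}$, let $L$ be the non-negative self-adjoint operator on $\ell^2(V,m)$ associated with the closed form $Q^D_m$, and $e^{-tL}$ its semigroup. The form $Q^D_m$ is called recurrent if $\int_0^\infty (e^{-tL}\delta_x)(y)\,dt=\infty$ for all $x,y\in V$, where $\delta_x$ is the indicator function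 of $\{x\}$. For $u\in\widetilde D$ put $(\widetilde L_mu)(x)=\frac1{m(x)}\sum_y b(x,y)(u(x)-u(y))$ and $(\widetilde\Delta u)(x)=\sum_y b(x,y)(u(x)-u(y))$ (the sums converge absolutely). Then the following are equivalent: 1. $Q^D_m$ is recurrent for some measure $m$ of full support. 2. $Q^D_m$ is recurrent for every measure $m$ of full support. 3. For every measure $m$ of full support and every $\alpha>0$ the equation $(\widetilde L_m+\alpha)u=0$ has a unique solution in $\widetilde D$ (namely $u=0$). 4. There is a finite measure $m$ of full support such that for every $\alpha>0$ the equation $(\widetilde L_m+\alpha)u=0$ has a unique solution in $\widetilde D$. 5. For every $v:V\to(0,\infty)$ the equation $(\widetilde\Delta+v)u=0$ has a unique solution in $\widetilde D$. 6. There is $v:V\to(0,\infty)$ with $\sum_x v(x)<\infty$ such that the equation $(\widetilde\Delta+v)u=0$ has a unique solution in $\widetilde D$. -/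

import Mathlib

section

open Filter Topology

variable {H : Type*} [NormedAddCommGroup H] [InnerProductSpace ℝ H] [CompleteSpace H]

/-- The Yosida approximation `a (1 - a R_a)` built from a family of resolvents
`R_a = (L + a)⁻¹`; it equals `a L (L + a)⁻¹`. -/
noncomputable def yosida (R : ℝ → H →L[ℝ] H) (a : ℝ) : H →L[ℝ] H := a • (1 - a • R a)

theorem exists_limit_of_dense {T : ℝ → H →L[ℝ] H} {s : Set H} (hs : Dense s)
    (hT : ∀ a, 0 < a → ∀ f, ‖T a f‖ ≤ ‖f‖)
    (h : ∀ f ∈ s, ∃ g, Tendsto (fun a => T a f) atTop (𝓝 g)) (f : H) :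
    ∃ g, Tendsto (fun a => T a f) atTop (𝓝 g) := by
  apply cauchySeq_tendsto_of_complete
  rw [Metric.cauchySeq_iff]
  intro ε hε
  obtain ⟨f', hf', hd⟩ := Metric.dense_iff.1 hs f (ε / 4) (by positivity)
  obtain ⟨g, hg⟩ := h f' hd
  obtain ⟨N, hN⟩ := Metric.cauchySeq_iff.1 hg.cauchySeq (ε / 4) (by positivity)
  refine ⟨max N 1, fun a ha b hb => ?_⟩
  have ha1 : 0 < a := by linarith [le_max_right N 1, (show max N 1 ≤ a from ha)]
  have hb1 : 0 < b := by linarith [le_max_right N 1, (show max N 1 ≤ b from hb)]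
  have h1 := hN a (le_trans (le_max_left N 1) ha) b (le_trans (le_max_left N 1) hb)
  have h2 : ‖f - f'‖ < ε / 4 := by rw [← dist_eq_norm, dist_comm]; exact hf'
  have h3 := hT a ha1 (f - f')
  have h4 := hT b hb1 (f - f')
  rw [map_sub] at h3 h4
  rw [dist_eq_norm] at h1 ⊢
  have : T a f - T b f = (T a f - T a f') + (T a f' - T b f') - (T b f - T b f') := by abel
  rw [this]
  calc _ ≤ ‖T a f - T a f'‖ + ‖T a f' - T b f'‖ + ‖T b f - T b f'‖ :=
        (norm_sub_le _ _).trans (by gcongr; exact norm_add_le _ _)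
    _ < ε := by linarith

theorem norm_exp_yosida_le {R : ℝ → H →L[ℝ] H} (hb : ∀ a, 0 < a → ∀ f, a * ‖R a f‖ ≤ ‖f‖)
    {a t : ℝ} (ha : 0 < a) (ht : 0 ≤ t) (f : H) :
    ‖NormedSpace.exp (-t • yosida R a) f‖ ≤ ‖f‖ := by
  have h1 : -t • yosida R a = (-(t * a)) • (1 : H →L[ℝ] H) + (t * a) • (a • R a) := by
    rw [yosida, smul_smul, smul_sub]; simp [neg_smul, sub_eq_add_neg]
  have hn : ‖a • R a‖ ≤ 1 := by
    refine ContinuousLinearMap.opNorm_le_bound _ zero_le_one fun f => ?_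
    simpa [norm_smul, abs_of_pos ha] using hb a ha f
  have h2 : NormedSpace.exp (-t • yosida R a) =
      Real.exp (-(t * a)) • NormedSpace.exp ((t * a) • (a • R a)) := by
    let _ : NormedAlgebra ℚ (H →L[ℝ] H) := NormedAlgebra.restrictScalars ℚ ℝ _
    rw [h1, NormedSpace.exp_add_of_commute]
    · rw [← Algebra.algebraMap_eq_smul_one, ← NormedSpace.algebraMap_exp_comm,
        ← Real.exp_eq_exp_ℝ, Algebra.algebraMap_eq_smul_one, smul_one_mul]
    · exact (Commute.one_left _).smul_left _
  have h3 : ‖NormedSpace.exp (-t • yosida R a)‖ ≤ 1 := by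
    rw [h2, norm_smul, Real.norm_eq_abs, Real.abs_exp]
    have h4 : ‖NormedSpace.exp ((t * a) • (a • R a))‖ ≤ Real.exp (t * a) := by
      have hle : ∀ n : ℕ, ‖((n.factorial : ℝ)⁻¹) • ((t * a) • (a • R a)) ^ n‖ ≤
          ((n.factorial : ℝ)⁻¹) • (t * a) ^ n := by
        intro n
        rw [norm_smul, smul_eq_mul, norm_inv, RCLike.norm_natCast]
        gcongr
        have hta : ‖(t * a) • (a • R a)‖ ≤ t * a := by
          rw [norm_smul, Real.norm_of_nonneg (by positivity)]
          exact mul_le_of_le_one_right (by positivity) hn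
        rcases n.eq_zero_or_pos with rfl | hn0
        · rw [pow_zero, pow_zero]; exact ContinuousLinearMap.norm_id_le
        · exact (norm_pow_le' _ hn0).trans (pow_le_pow_left₀ (norm_nonneg _) hta n)
      rw [NormedSpace.exp_eq_tsum ℝ, Real.exp_eq_exp_ℝ, NormedSpace.exp_eq_tsum ℝ]
      exact tsum_of_norm_bounded (NormedSpace.expSeries_summable' (𝕂 := ℝ) (t * a)).hasSum hle
    calc _ ≤ Real.exp (-(t * a)) * Real.exp (t * a) := by gcongr
      _ = 1 := by rw [← Real.exp_add]; simp
  simpa using ContinuousLinearMap.le_of_opNorm_le _ h3 f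

theorem exists_yosida_limit {R : ℝ → H →L[ℝ] H} (hb : ∀ a, 0 < a → ∀ f, a * ‖R a f‖ ≤ ‖f‖)
    (hres : ∀ a b, 0 < a → 0 < b → R a - R b = (b - a) • (R a * R b))
    (hd : DenseRange (R 1)) {t : ℝ} (ht : 0 ≤ t) (f : H) :
    ∃ g, Tendsto (fun a => NormedSpace.exp (-t • yosida R a) f) atTop (𝓝 g) := by
  have hcR : ∀ a b, 0 < a → 0 < b → Commute (R a) (R b) := by
    intro a b ha hb'
    rcases eq_or_ne a b with rfl | hab
    · exact Commute.refl _
    · have h1 := hres a b ha hb'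
      have h2 := hres b a hb' ha
      have h3 : (b - a) • (R a * R b - R b * R a) = 0 := by
        have : (b - a) • (R b * R a) = - ((a - b) • (R b * R a)) := by
          rw [← neg_smul]; congr 1; ring
        rw [smul_sub, this, ← h1, ← h2]; abel
      rcases smul_eq_zero.1 h3 with h | h
      · exact absurd (sub_eq_zero.1 h).symm hab
      · exact sub_eq_zero.1 h
  have hcY : ∀ a b, 0 < a → 0 < b → Commute (yosida R a) (yosida R b) := by
    intro a b ha hb'
    refine Commute.smul_left (Commute.smul_right ?_ _) _
    refine Commute.sub_left (Commute.one_left _) (Commute.sub_right (Commute.one_right _) ?_)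
    exact ((hcR a b ha hb').smul_left _).smul_right _
  -- strong convergence `a R_a → 1`
  have hstrong : ∀ f, Tendsto (fun a => (a • R a) f) atTop (𝓝 f) := by
    intro f
    rw [Metric.tendsto_atTop]
    intro ε hε
    obtain ⟨f', hf', k, rfl⟩ := Metric.dense_iff.1 hd f (ε / 3) (by positivity)
    refine ⟨max 1 (3 * ‖R 1 k - k‖ / ε + 1), fun a ha => ?_⟩
    have ha0 : 0 < a := by linarith [le_max_left 1 (3 * ‖R 1 k - k‖ / ε + 1)]
    have ha2 : 3 * ‖R 1 k - k‖ / ε < a := by linarith [le_max_right 1 (3 * ‖R 1 k - k‖ / ε + 1)]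
    have e1 : (a • R a) (R 1 k) - R 1 k = R a (R 1 k - k) := by
      have := congrArg (fun T : H →L[ℝ] H => T k) (hres a 1 ha0 one_pos)
      simp only [sub_apply, smul_apply,
        mul_apply_eq_comp, sub_smul, one_smul] at this
      simp only [smul_apply, map_sub]
      rw [sub_eq_iff_eq_add] at this ⊢
      rw [this]; abel
    have e2 : ‖R a (R 1 k - k)‖ < ε / 3 := by
      have := hb a ha0 (R 1 k - k)
      rw [div_lt_iff₀ hε] at ha2
      by_contra hcon
      push Not at hcon
      nlinarith
    have e3 : ‖f - R 1 k‖ < ε / 3 := by rw [← dist_eq_norm, dist_comm]; exact hf'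
    have e4 : ‖(a • R a) (f - R 1 k)‖ ≤ ‖f - R 1 k‖ := by
      simpa [norm_smul, abs_of_pos ha0] using hb a ha0 (f - R 1 k)
    rw [dist_eq_norm]
    have : (a • R a) f - f = (a • R a) (f - R 1 k) + ((a • R a) (R 1 k) - R 1 k) - (f - R 1 k) := by
      rw [map_sub]; abel
    rw [this, e1]
    calc _ ≤ ‖(a • R a) (f - R 1 k)‖ + ‖R a (R 1 k - k)‖ + ‖f - R 1 k‖ :=
          (norm_sub_le _ _).trans (by gcongr; exact norm_add_le _ _)
      _ < ε := by linarith
  refine exists_limit_of_dense hd (fun a ha f => norm_exp_yosida_le hb ha ht f) ?_ f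
  rintro _ ⟨k, rfl⟩
  apply cauchySeq_tendsto_of_complete
  -- convergence of the generators on the range of `R 1`
  have hgen : Tendsto (fun a => yosida R a (R 1 k)) atTop (𝓝 (k - R 1 k)) := by
    refine (hstrong (k - R 1 k)).congr' ?_
    filter_upwards [eventually_gt_atTop 0] with a ha
    have := congrArg (fun T : H →L[ℝ] H => T k) (hres a 1 ha one_pos)
    simp only [sub_apply, smul_apply,
      mul_apply_eq_comp, sub_smul, one_smul] at this
    simp only [yosida, smul_apply, map_sub, sub_apply,
      one_apply_eq_self]
    rw [← smul_sub]
    congr 1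
    rw [sub_eq_iff_eq_add] at this
    rw [this]; abel
  have key : ∀ a b, 0 < a → 0 < b →
      ‖NormedSpace.exp (-t • yosida R a) (R 1 k) - NormedSpace.exp (-t • yosida R b) (R 1 k)‖
        ≤ t * ‖yosida R b (R 1 k) - yosida R a (R 1 k)‖ := by
    intro a b ha hb'
    let _ : NormedAlgebra ℚ (H →L[ℝ] H) := NormedAlgebra.restrictScalars ℚ ℝ _
    set X := -t • yosida R a with hX
    set Y := -t • yosida R b with hY
    have hXY : Commute X Y := ((hcY a b ha hb').smul_left _).smul_right _
    let F : ℝ → H →L[ℝ] H := fun s => NormedSpace.exp (s • X) * NormedSpace.exp ((1 - s) • Y)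
    have hF : ∀ s, HasDerivAt F (F s * (X - Y)) s := by
      intro s
      have h1 := hasDerivAt_exp_smul_const (𝕂 := ℝ) X s
      have h2 := (hasDerivAt_exp_smul_const (𝕂 := ℝ) Y (1 - s)).scomp s
        ((hasDerivAt_id s).const_sub 1)
      have hc : Commute X (NormedSpace.exp ((1 - s) • Y)) := (hXY.smul_right _).exp_right
      have h3 : F s * (X - Y) = NormedSpace.exp (s • X) * X * NormedSpace.exp ((1 - s) • Y) +
          NormedSpace.exp (s • X) * (-1 : ℝ) • (NormedSpace.exp ((1 - s) • Y) * Y) := by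
        simp only [F, neg_smul, one_smul, mul_neg, mul_sub, mul_assoc]
        rw [hc.eq, sub_eq_add_neg]
      rw [h3]
      exact h1.mul h2
    have hfs : ∀ s ∈ Set.Icc (0 : ℝ) 1,
        HasDerivWithinAt (fun s => F s (R 1 k)) ((F s * (X - Y)) (R 1 k)) (Set.Icc 0 1) s :=
      fun s _ => ((hF s).clm_apply (hasDerivAt_const s (R 1 k))).hasDerivWithinAt.congr_deriv
        (by simp)
    have := norm_image_sub_le_of_norm_deriv_le_segment_01'
      (C := t * ‖yosida R b (R 1 k) - yosida R a (R 1 k)‖) hfs ?_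
    · simpa [F] using this
    · intro s hs
      have e1 : s • X = -(s * t) • yosida R a := by rw [hX, smul_smul]; congr 1; ring
      have e2 : (1 - s) • Y = -((1 - s) * t) • yosida R b := by rw [hY, smul_smul]; congr 1; ring
      have e3 : (X - Y) (R 1 k) = t • (yosida R b (R 1 k) - yosida R a (R 1 k)) := by
        simp only [hX, hY, sub_apply, neg_smul, neg_apply, smul_apply, smul_sub]; abel
      have e4 : ‖(X - Y) (R 1 k)‖ = t * ‖yosida R b (R 1 k) - yosida R a (R 1 k)‖ := by
        rw [e3, norm_smul, Real.norm_of_nonneg ht]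
      rw [← e4]
      simp only [F, mul_apply_eq_comp, e1, e2]
      exact (norm_exp_yosida_le hb ha (mul_nonneg hs.1 ht) _).trans
        (norm_exp_yosida_le hb hb' (mul_nonneg (by linarith [hs.2]) ht) _)
  rw [Metric.cauchySeq_iff]
  intro ε hε
  obtain ⟨N, hN⟩ := Metric.cauchySeq_iff.1 hgen.cauchySeq (ε / (t + 1)) (by positivity)
  refine ⟨max N 1, fun a ha b hb' => ?_⟩
  have ha1 : 0 < a := by linarith [le_max_right N 1, (show max N 1 ≤ a from ha)]
  have hb1 : 0 < b := by linarith [le_max_right N 1, (show max N 1 ≤ b from hb')]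
  have h1 := hN b (le_trans (le_max_left N 1) hb') a (le_trans (le_max_left N 1) ha)
  rw [dist_eq_norm] at h1 ⊢
  refine (key a b ha1 hb1).trans_lt ?_
  rw [lt_div_iff₀ (by positivity)] at h1
  nlinarith [norm_nonneg (yosida R b (R 1 k) - yosida R a (R 1 k))]
end

/-- The real line with inner product `⟪s, t⟫ = w s t`, where `w > 0`. -/
def WeightedLine (_w : Set.Ioi (0 : ℝ)) : Type := ℝ

namespace WeightedLine

variable (w : Set.Ioi (0 : ℝ))

instance : AddCommGroup (WeightedLine w) := inferInstanceAs (AddCommGroup ℝ)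

instance : Module ℝ (WeightedLine w) := inferInstanceAs (Module ℝ ℝ)

@[reducible] noncomputable def core : InnerProductSpace.Core ℝ (WeightedLine w) where
  inner s t := (w : ℝ) * ((show ℝ from s) * (show ℝ from t))
  conj_inner_symm s t := by
    change (w : ℝ) * ((show ℝ from t) * (show ℝ from s)) = _
    rw [mul_comm (show ℝ from t)]
  re_inner_nonneg s := mul_nonneg (le_of_lt w.2) (mul_self_nonneg (show ℝ from s))
  add_left s t r := by
    change (w : ℝ) * (((show ℝ from s) + (show ℝ from t)) * (show ℝ from r)) = _
    ring
  smul_left s t r := by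
    change (w : ℝ) * ((r * (show ℝ from s)) * (show ℝ from t)) =
      r * ((w : ℝ) * ((show ℝ from s) * (show ℝ from t)))
    ring
  definite s h := by
    have h2 : (w : ℝ) * ((show ℝ from s) * (show ℝ from s)) = 0 := h
    have h3 : (w : ℝ) ≠ 0 := ne_of_gt w.2
    exact mul_self_eq_zero.1 ((mul_eq_zero.1 h2).resolve_left h3)

noncomputable instance : NormedAddCommGroup (WeightedLine w) := (core w).toNormedAddCommGroup

noncomputable instance : InnerProductSpace ℝ (WeightedLine w) := InnerProductSpace.ofCore (core w).toCore

instance : Module.Finite ℝ (WeightedLine w) := inferInstanceAs (Module.Finite ℝ ℝ)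

instance : CompleteSpace (WeightedLine w) := FiniteDimensional.complete ℝ _

theorem inner_eq (s t : WeightedLine w) :
    inner ℝ s t = (w : ℝ) * ((show ℝ from s) * (show ℝ from t)) := rfl

end WeightedLine

/-- The Hilbert space `ℓ²(V, m)`. -/
abbrev EllTwo {V : Type*} (m : V → Set.Ioi (0 : ℝ)) : Type _ := lp (fun x => WeightedLine (m x)) 2

namespace EllTwo

variable {V : Type*} {m : V → Set.Ioi (0 : ℝ)}

/-- An element of `ℓ²(V, m)` as a real valued function on `V`. -/
def fn : EllTwo m →ₗ[ℝ] (V → ℝ) where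
  toFun u := fun x => u x
  map_add' _ _ := rfl
  map_smul' _ _ := rfl

theorem inner_eq (u v : EllTwo m) : inner ℝ u v = ∑' x, (m x : ℝ) * (fn u x * fn v x) :=
  lp.inner_eq_tsum u v

open Classical in
/-- The function `δ_x`. -/
noncomputable def delta (x : V) : EllTwo m := lp.single 2 x (1 : ℝ)

theorem norm_sq_weightedLine (w : Set.Ioi (0 : ℝ)) (s : WeightedLine w) :
    ‖s‖ ^ 2 = (w : ℝ) * (show ℝ from s) ^ 2 := by
  rw [← real_inner_self_eq_norm_sq, WeightedLine.inner_eq, sq]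

/-- The functions on `V` that represent elements of `ℓ²(V, m)` are exactly the `u` with
`∑ u(x)² m(x) < ∞`. -/
theorem exists_fn_eq_iff (f : V → ℝ) :
    (∃ u : EllTwo m, fn u = f) ↔ Summable fun x => (m x : ℝ) * f x ^ 2 := by
  have key : ∀ g : (x : V) → WeightedLine (m x),
      Memℓp g 2 ↔ Summable fun x => (m x : ℝ) * (show ℝ from g x) ^ 2 := by
    intro g
    rw [memℓp_gen_iff (by norm_num)]
    refine summable_congr fun x => ?_
    rw [ENNReal.toReal_ofNat, Real.rpow_two, norm_sq_weightedLine]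
  constructor
  · rintro ⟨u, rfl⟩
    exact (key u).1 (lp.memℓp u)
  · intro h
    exact ⟨⟨f, (key f).2 h⟩, rfl⟩

theorem continuous_fn_apply (x : V) : Continuous fun u : EllTwo m => fn u x := by
  have h : LipschitzWith (Real.toNNReal (√(m x : ℝ))⁻¹) fun u : EllTwo m => fn u x := by
    refine LipschitzWith.of_dist_le_mul fun u v => ?_
    have h1 : ‖(u - v) x‖ ≤ ‖u - v‖ := lp.norm_apply_le_norm (by norm_num) (u - v) x
    have h2 := norm_sq_weightedLine (m x) ((u - v) x)
    have h3 : (show ℝ from (u - v) x) = fn u x - fn v x := rfl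
    have hm : (0 : ℝ) < m x := (m x).2
    rw [h3] at h2
    have h4 : ‖(u - v) x‖ = √(m x : ℝ) * |fn u x - fn v x| := by
      rw [← Real.sqrt_sq (norm_nonneg ((u - v) x)), h2, Real.sqrt_mul hm.le, Real.sqrt_sq_eq_abs]
    rw [h4] at h1
    rw [Real.dist_eq, dist_eq_norm, Real.coe_toNNReal _ (by positivity), inv_mul_eq_div,
      le_div_iff₀ (by positivity), mul_comm]
    exact h1
  exact h.continuous

open Classical in
theorem fn_delta (x : V) : fn (delta x : EllTwo m) = Pi.single x 1 := by
  ext y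
  change (Pi.single x (1 : ℝ) : (x : V) → WeightedLine (m x)) y = _
  rcases eq_or_ne y x with rfl | h
  · rw [Pi.single_eq_same (M := fun _ : V => ℝ)]
    exact Pi.single_eq_same (M := fun x => WeightedLine (m x)) y _
  · rw [Pi.single_eq_of_ne (M := fun _ : V => ℝ) h]
    exact Pi.single_eq_of_ne (M := fun x => WeightedLine (m x)) h _

end EllTwo

/-- A weighted graph `(b, 0)` over `V`. -/
structure WeightedGraph (V : Type*) where
  b : V → V → ℝ
  nonneg : ∀ x y, 0 ≤ b x y
  loopless : ∀ x, b x x = 0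
  symm : ∀ x y, b x y = b y x
  summable : ∀ x, Summable fun y => b x y

namespace WeightedGraph

open EllTwo

variable {V : Type*} (G : WeightedGraph V)

/-- Any two vertices are joined by a path of edges of positive weight. -/
def Connected : Prop := ∀ x y, Relation.ReflTransGen (fun x y => 0 < G.b x y) x y

/-- The space `D̃` of functions of finite energy, i.e. `∑ b(x,y) (u(x) - u(y))² < ∞`. -/
def finiteEnergy : Submodule ℝ (V → ℝ) where
  carrier := {u | Summable fun p : V × V => G.b p.1 p.2 * (u p.1 - u p.2) ^ 2}
  zero_mem' := by simp
  add_mem' {u v} hu hv := by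
    refine Summable.of_nonneg_of_le (fun p => mul_nonneg (G.nonneg _ _) (sq_nonneg _)) (fun p => ?_)
      ((Summable.add hu hv).mul_left 2)
    have := G.nonneg p.1 p.2
    simp only [Pi.add_apply]
    nlinarith [mul_nonneg this (sq_nonneg ((u p.1 - u p.2) - (v p.1 - v p.2)))]
  smul_mem' c u hu := by
    refine (Summable.mul_left (c ^ 2) hu).congr fun p => ?_
    simp only [Pi.smul_apply, smul_eq_mul]
    ring

/-- The energy form `Q̃(u, v) = 1/2 ∑ b(x,y) (u(x) - u(y)) (v(x) - v(y))`; the sum converges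
absolutely for `u, v` of finite energy. -/
noncomputable def energy (u v : V → ℝ) : ℝ :=
  1 / 2 * ∑' p : V × V, G.b p.1 p.2 * ((u p.1 - u p.2) * (v p.1 - v p.2))

/-- The formal Laplacian `(L̃_m u)(x) = 1 / m(x) ∑_y b(x,y) (u(x) - u(y))`; for `u` of finite
energy the sum converges absolutely, see `summable_laplacian`. -/
noncomputable def formalLaplacian (m : V → Set.Ioi (0 : ℝ)) (u : V → ℝ) (x : V) : ℝ :=
  1 / (m x : ℝ) * ∑' y, G.b x y * (u x - u y)

/-- The operator `(Δ̃ u)(x) = ∑_y b(x,y) (u(x) - u(y))`. -/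
noncomputable def laplacian (u : V → ℝ) (x : V) : ℝ := ∑' y, G.b x y * (u x - u y)

theorem summable_laplacian {u : V → ℝ} (hu : u ∈ G.finiteEnergy) (x : V) :
    Summable fun y => G.b x y * (u x - u y) := by
  have h1 : Summable fun y => G.b x y * (u x - u y) ^ 2 :=
    Summable.comp_injective (i := fun y => (x, y)) hu fun _ _ h => (Prod.mk.inj h).2
  refine Summable.of_norm_bounded ((G.summable x).add h1) fun y => ?_
  have := G.nonneg x y
  rw [Real.norm_eq_abs, abs_mul, abs_of_nonneg this]
  nlinarith [mul_nonneg this (sq_nonneg (|u x - u y| - 1)), sq_abs (u x - u y),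
    mul_nonneg this (abs_nonneg (u x - u y))]

variable (m : V → Set.Ioi (0 : ℝ))

/-- The form norm `(Q̃(u) + ‖u‖²)^{1/2}`. -/
noncomputable def formNorm (u : EllTwo m) : ℝ := √(G.energy (fn u) (fn u) + ‖u‖ ^ 2)

/-- The domain of the regular Dirichlet form `Q^D_m`: the closure of the finitely supported
functions in `D̃ ∩ ℓ²(V, m)` with respect to the form norm. -/
def regularDomain : Set (EllTwo m) :=
  {u | fn u ∈ G.finiteEnergy ∧
    ∀ ε > 0, ∃ φ : EllTwo m, (Function.support (fn φ)).Finite ∧ G.formNorm m (u - φ) < ε}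

/-- `u` belongs to the domain of the operator `L` associated with `Q^D_m`, and `L u = w`. -/
def IsOperator (u w : EllTwo m) : Prop :=
  u ∈ G.regularDomain m ∧ ∀ v ∈ G.regularDomain m, G.energy (fn u) (fn v) = inner ℝ w v

/-! ### The resolvent of the regular form -/

theorem summable_energy {u v : V → ℝ} (hu : u ∈ G.finiteEnergy) (hv : v ∈ G.finiteEnergy) :
    Summable fun p : V × V => G.b p.1 p.2 * ((u p.1 - u p.2) * (v p.1 - v p.2)) := by
  refine Summable.of_norm_bounded (Summable.add hu hv) fun p => ?_
  have := G.nonneg p.1 p.2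
  rw [Real.norm_eq_abs, abs_mul, abs_of_nonneg this, abs_mul, ← mul_add]
  refine mul_le_mul_of_nonneg_left ?_ this
  nlinarith [sq_nonneg (|u p.1 - u p.2| - |v p.1 - v p.2|), sq_abs (u p.1 - u p.2),
    sq_abs (v p.1 - v p.2), sq_nonneg (u p.1 - u p.2), sq_nonneg (v p.1 - v p.2)]

/-- Finitely supported functions have finite energy. -/
theorem finiteEnergy_of_finite_support {u : V → ℝ} (hu : (Function.support u).Finite) :
    u ∈ G.finiteEnergy := by
  classical
  have hs : u = ∑ x ∈ hu.toFinset, u x • Pi.single x (1 : ℝ) := by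
    ext y
    rw [Finset.sum_apply]
    simp only [Pi.smul_apply, Pi.single_apply, smul_eq_mul, mul_ite, mul_one, mul_zero]
    rw [Finset.sum_ite_eq]
    simp
  rw [hs]
  refine Submodule.sum_mem _ fun x _ => Submodule.smul_mem _ _ ?_
  have h1 : Summable fun p : V × V => if p.1 = x then G.b x p.2 else 0 := by
    refine (Function.Injective.summable_iff (g := fun y => (x, y))
      (fun _ _ h => (Prod.mk.inj h).2) ?_).1 ?_
    · rintro ⟨p, q⟩ hpq
      rw [if_neg]
      rintro rfl
      exact hpq ⟨q, rfl⟩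
    · simpa [Function.comp_def] using G.summable x
  have h2 : Summable fun p : V × V => if p.2 = x then G.b x p.1 else 0 := by
    simpa [Function.comp_def] using (Equiv.prodComm V V).summable_iff.2 h1
  refine Summable.of_nonneg_of_le (fun p => mul_nonneg (G.nonneg _ _) (sq_nonneg _)) (fun p => ?_)
    (h1.add h2)
  obtain ⟨p, q⟩ := p
  have h0 := G.nonneg
  by_cases hp : p = x <;> by_cases hq : q = x <;>
    simp [hp, hq, G.loopless, G.symm p x]

/-- The space of edge functions in which gradients live. -/
abbrev EdgeSpace (V : Type*) : Type _ := lp (fun _ : V × V => ℝ) 2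

/-- Weighted gradient. -/
noncomputable def grad (u : V → ℝ) (p : V × V) : ℝ := √(G.b p.1 p.2 / 2) * (u p.1 - u p.2)

theorem grad_sq (u : V → ℝ) (p : V × V) :
    ‖G.grad u p‖ ^ 2 = 1 / 2 * (G.b p.1 p.2 * (u p.1 - u p.2) ^ 2) := by
  have := G.nonneg p.1 p.2
  rw [Real.norm_eq_abs, sq_abs, grad, mul_pow, Real.sq_sqrt (by positivity)]
  ring

theorem memℓp_grad_iff (u : V → ℝ) : Memℓp (G.grad u) 2 ↔ u ∈ G.finiteEnergy := by
  rw [memℓp_gen_iff (by norm_num)]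
  simp only [ENNReal.toReal_ofNat, Real.rpow_two, grad_sq]
  exact summable_mul_left_iff (by norm_num)

theorem inner_grad {e f : EdgeSpace V} {u v : V → ℝ} (he : ∀ p, e p = G.grad u p)
    (hf : ∀ p, f p = G.grad v p) : inner ℝ e f = G.energy u v := by
  rw [lp.inner_eq_tsum, energy, ← tsum_mul_left]
  refine tsum_congr fun p => ?_
  have := G.nonneg p.1 p.2
  rw [he, hf, grad, grad, RCLike.inner_apply, conj_trivial]
  have h := Real.mul_self_sqrt (show 0 ≤ G.b p.1 p.2 / 2 by positivity)
  linear_combination (u p.1 - u p.2) * (v p.1 - v p.2) * h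

/-- The graph of the gradient on finitely supported functions. -/
def gradGraph : Submodule ℝ (WithLp 2 (EllTwo m × EdgeSpace V)) where
  carrier := {p | (Function.support (fn p.fst)).Finite ∧ ∀ e, p.snd e = G.grad (fn p.fst) e}
  zero_mem' := by
    refine ⟨?_, fun e => ?_⟩
    · simp
    · simp [grad]
  add_mem' {p q} hp hq := by
    refine ⟨?_, fun e => ?_⟩
    · rw [WithLp.add_fst, map_add]
      exact (hp.1.union hq.1).subset (Function.support_add _ _)
    · rw [WithLp.add_snd, WithLp.add_fst, map_add, lp.coeFn_add, Pi.add_apply, hp.2, hq.2]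
      simp only [grad, Pi.add_apply]; ring
  smul_mem' c p hp := by
    refine ⟨?_, fun e => ?_⟩
    · rw [WithLp.smul_fst, map_smul]
      exact hp.1.subset (Function.support_const_smul_subset _ _)
    · rw [WithLp.smul_snd, WithLp.smul_fst, map_smul, lp.coeFn_smul, Pi.smul_apply, hp.2]
      simp only [grad, Pi.smul_apply, smul_eq_mul]; ring

theorem formNorm_eq {p : WithLp 2 (EllTwo m × EdgeSpace V)}
    (hp : ∀ e, p.snd e = G.grad (fn p.fst) e) : G.formNorm m p.fst = ‖p‖ := by
  rw [formNorm, ← G.inner_grad hp hp, real_inner_self_eq_norm_sq, add_comm,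
    ← WithLp.prod_norm_sq_eq_of_L2, Real.sqrt_sq (norm_nonneg _)]

theorem snd_eq_grad_of_mem {p : WithLp 2 (EllTwo m × EdgeSpace V)}
    (hp : p ∈ (G.gradGraph m).topologicalClosure) (e : V × V) :
    p.snd e = G.grad (fn p.fst) e := by
  have hcl : IsClosed {p : WithLp 2 (EllTwo m × EdgeSpace V) | p.snd e = G.grad (fn p.fst) e} := by
    have c1 : Continuous fun p : WithLp 2 (EllTwo m × EdgeSpace V) => p.fst :=
      (WithLp.fstL 2 ℝ (EllTwo m) (EdgeSpace V)).continuous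
    have c2 : Continuous fun p : WithLp 2 (EllTwo m × EdgeSpace V) => p.snd :=
      (WithLp.sndL 2 ℝ (EllTwo m) (EdgeSpace V)).continuous
    refine isClosed_eq ((lp.evalCLM ℝ (fun _ : V × V => ℝ) 2 e).continuous.comp c2) ?_
    exact continuous_const.mul
      (((continuous_fn_apply e.1).comp c1).sub ((continuous_fn_apply e.2).comp c1))
  exact closure_minimal (fun p hp => hp.2 e) hcl hp

theorem fst_mem_regularDomain {p : WithLp 2 (EllTwo m × EdgeSpace V)}
    (hp : p ∈ (G.gradGraph m).topologicalClosure) : p.fst ∈ G.regularDomain m := by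
  have h1 := G.snd_eq_grad_of_mem m hp
  refine ⟨(G.memℓp_grad_iff _).1 ?_, fun ε hε => ?_⟩
  · rw [← funext h1]
    exact lp.memℓp p.snd
  · obtain ⟨q, hq, hd⟩ := Metric.mem_closure_iff.1 hp ε hε
    refine ⟨q.fst, hq.1, ?_⟩
    rw [dist_eq_norm] at hd
    rw [← WithLp.sub_fst, G.formNorm_eq m]
    · exact hd
    · exact G.snd_eq_grad_of_mem m
        (Submodule.sub_mem _ hp ((G.gradGraph m).le_topologicalClosure hq))

theorem exists_mem_of_mem_regularDomain {u : EllTwo m} (hu : u ∈ G.regularDomain m) :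
    ∃ p ∈ (G.gradGraph m).topologicalClosure, p.fst = u := by
  have key : ∀ v : EllTwo m, fn v ∈ G.finiteEnergy →
      ∃ p : WithLp 2 (EllTwo m × EdgeSpace V), p.fst = v ∧ ∀ e, p.snd e = G.grad (fn v) e :=
    fun v hv => ⟨WithLp.toLp 2 (v, ⟨G.grad (fn v), (G.memℓp_grad_iff _).2 hv⟩), rfl, fun _ => rfl⟩
  obtain ⟨p, rfl, hp⟩ := key u hu.1
  refine ⟨p, ?_, rfl⟩
  refine Metric.mem_closure_iff.2 fun ε hε => ?_
  obtain ⟨φ, hφ, hd⟩ := hu.2 ε hε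
  obtain ⟨q, rfl, hq⟩ := key φ (G.finiteEnergy_of_finite_support hφ)
  refine ⟨q, ⟨hφ, hq⟩, ?_⟩
  rw [dist_eq_norm]
  rw [← WithLp.sub_fst, G.formNorm_eq m] at hd
  · exact hd
  · intro e
    rw [WithLp.sub_snd, WithLp.sub_fst, map_sub, lp.coeFn_sub, Pi.sub_apply, hp, hq]
    simp only [grad, Pi.sub_apply]; ring

/-- For `a > 0` the operator `L + a` has a bounded right inverse; since `L` is non-negative it is
the inverse. -/
theorem exists_resolvent {a : ℝ} (ha : 0 < a) :
    ∃ R : EllTwo m →L[ℝ] EllTwo m, ∀ f, G.IsOperator m (R f) (f - a • R f) := by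
  let K := (G.gradGraph m).topologicalClosure
  have : CompleteSpace K := (G.gradGraph m).isClosed_topologicalClosure.completeSpace_coe
  obtain ⟨P, hP⟩ : ∃ P : K →L[ℝ] EllTwo m, ∀ p : K, P p = p.1.fst :=
    ⟨(WithLp.fstL 2 ℝ (EllTwo m) (EdgeSpace V)).comp K.subtypeL, fun _ => rfl⟩
  obtain ⟨S, hS⟩ : ∃ S : K →L[ℝ] EdgeSpace V, ∀ p : K, S p = p.1.snd :=
    ⟨(WithLp.sndL 2 ℝ (EllTwo m) (EdgeSpace V)).comp K.subtypeL, fun _ => rfl⟩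
  let B : K →L[ℝ] K →L[ℝ] ℝ := LinearMap.mkContinuous₂
    (LinearMap.mk₂ ℝ (fun p q => a * inner ℝ (P p) (P q) + inner ℝ (S p) (S q))
      (fun p q r => by simp only [map_add, inner_add_left]; ring)
      (fun c p q => by simp only [map_smul, real_inner_smul_left, smul_eq_mul]; ring)
      (fun p q r => by simp only [map_add, inner_add_right]; ring)
      (fun c p q => by simp only [map_smul, real_inner_smul_right, smul_eq_mul]; ring))
    (a * (‖P‖ * ‖P‖) + ‖S‖ * ‖S‖) (fun p q => by
      simp only [LinearMap.mk₂_apply]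
      have h1 := (abs_real_inner_le_norm (P p) (P q)).trans
        (mul_le_mul (P.le_opNorm p) (P.le_opNorm q) (norm_nonneg _) (by positivity))
      have h2 := (abs_real_inner_le_norm (S p) (S q)).trans
        (mul_le_mul (S.le_opNorm p) (S.le_opNorm q) (norm_nonneg _) (by positivity))
      rw [Real.norm_eq_abs]
      refine (abs_add_le _ _).trans ?_
      rw [abs_mul, abs_of_pos ha]
      nlinarith)
  have hB : ∀ p q, B p q = a * inner ℝ (P p) (P q) + inner ℝ (S p) (S q) := fun p q => rfl
  clear_value B
  have hco : IsCoercive B := by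
    refine ⟨min a 1, lt_min ha one_pos, fun p => ?_⟩
    rw [hB, real_inner_self_eq_norm_sq, real_inner_self_eq_norm_sq, mul_assoc, ← sq]
    have h1 : ‖p‖ ^ 2 = ‖P p‖ ^ 2 + ‖S p‖ ^ 2 := by
      rw [hP, hS]; exact WithLp.prod_norm_sq_eq_of_L2 p.1
    rw [h1]
    nlinarith [min_le_left a 1, min_le_right a 1, sq_nonneg ‖P p‖, sq_nonneg ‖S p‖]
  refine ⟨P.comp ((hco.continuousLinearEquivOfBilin.symm : K →L[ℝ] K).comp
    (ContinuousLinearMap.adjoint P)), fun f => ?_⟩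
  set p : K := hco.continuousLinearEquivOfBilin.symm (ContinuousLinearMap.adjoint P f) with hp
  change G.IsOperator m (P p) (f - a • P p)
  refine ⟨hP p ▸ G.fst_mem_regularDomain m p.2, fun v hv => ?_⟩
  obtain ⟨q, hq, rfl⟩ := G.exists_mem_of_mem_regularDomain m hv
  have h1 : inner ℝ (hco.continuousLinearEquivOfBilin p) (⟨q, hq⟩ : K) = B p ⟨q, hq⟩ :=
    hco.continuousLinearEquivOfBilin_apply p _
  rw [hp, ContinuousLinearEquiv.apply_symm_apply, ContinuousLinearMap.adjoint_inner_left, ← hp,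
    hB] at h1
  have h2 : inner ℝ (S p) (S ⟨q, hq⟩) = G.energy (fn (P p)) (fn q.fst) := by
    rw [hP, hS, hS]
    exact G.inner_grad (G.snd_eq_grad_of_mem m p.2) (G.snd_eq_grad_of_mem m hq)
  rw [inner_sub_left, real_inner_smul_left]
  have h3 : P ⟨q, hq⟩ = q.fst := hP _
  rw [h2, h3] at h1
  linarith

/-- The resolvent `(L + a)⁻¹` of the operator `L` associated with `Q^D_m`, for `a > 0`. -/
noncomputable def resolvent (a : ℝ) : EllTwo m →L[ℝ] EllTwo m :=
  open Classical in
  if ha : 0 < a then Classical.choose (G.exists_resolvent m ha) else 0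

theorem isOperator_resolvent {a : ℝ} (ha : 0 < a) (f : EllTwo m) :
    G.IsOperator m (G.resolvent m a f) (f - a • G.resolvent m a f) := by
  rw [resolvent, dif_pos ha]
  exact Classical.choose_spec (G.exists_resolvent m ha) f

theorem energy_self_nonneg (u : V → ℝ) : 0 ≤ G.energy u u :=
  mul_nonneg (by norm_num) (tsum_nonneg fun _ => mul_nonneg (G.nonneg _ _) (mul_self_nonneg _))

theorem energy_sub_left {u u' v : V → ℝ} (hu : u ∈ G.finiteEnergy) (hu' : u' ∈ G.finiteEnergy)
    (hv : v ∈ G.finiteEnergy) : G.energy (u - u') v = G.energy u v - G.energy u' v := by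
  rw [energy, energy, energy, ← mul_sub,
    ← (G.summable_energy hu hv).tsum_sub (G.summable_energy hu' hv)]
  congr 1
  refine tsum_congr fun p => ?_
  simp only [Pi.sub_apply]; ring

theorem energy_comm (u v : V → ℝ) : G.energy u v = G.energy v u := by
  simp only [energy, mul_comm (u _ - u _)]

/-- The element `(L + a)⁻¹ h` is the only `u` in the domain of `L` with `L u = h - a u`. -/
theorem resolvent_unique {a : ℝ} (ha : 0 < a) {g h : EllTwo m}
    (hg : G.IsOperator m g (h - a • g)) : G.resolvent m a h = g := by
  obtain ⟨h1, h2⟩ := G.isOperator_resolvent m ha h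
  obtain ⟨h3, h4⟩ := hg
  generalize G.resolvent m a h = u at h1 h2 ⊢
  have e1 := h2 u h1
  have e2 := h2 g h3
  have e3 := h4 u h1
  have e4 := h4 g h3
  rw [← sub_eq_zero, ← norm_eq_zero, ← sq_eq_zero_iff]
  have hE : 0 ≤ G.energy (fn u - fn g) (fn u - fn g) := G.energy_self_nonneg _
  rw [G.energy_sub_left h1.1 h3.1 (Submodule.sub_mem _ h1.1 h3.1), G.energy_comm (fn u),
    G.energy_comm (fn g), G.energy_sub_left h1.1 h3.1 h1.1, G.energy_sub_left h1.1 h3.1 h3.1,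
    G.energy_comm (fn g) (fn u), e1, e2, e4] at hE
  rw [G.energy_comm, e2] at e3
  have hn : ‖u - g‖ ^ 2 = inner ℝ u u - 2 * inner ℝ u g + inner ℝ g g := by
    rw [← real_inner_self_eq_norm_sq, inner_sub_left, inner_sub_right, inner_sub_right,
      real_inner_comm u g]
    ring
  simp only [inner_sub_left, real_inner_smul_left] at hE e3
  rw [real_inner_comm u g] at e3
  nlinarith [sq_nonneg ‖u - g‖]

theorem mul_norm_resolvent_le (a : ℝ) (ha : 0 < a) (f : EllTwo m) :
    a * ‖G.resolvent m a f‖ ≤ ‖f‖ := by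
  obtain ⟨h1, h2⟩ := G.isOperator_resolvent m ha f
  have h3 := h2 _ h1
  have h4 := G.energy_self_nonneg (fn (G.resolvent m a f))
  rw [h3, inner_sub_left, real_inner_smul_left, real_inner_self_eq_norm_sq] at h4
  have h5 := real_inner_le_norm f (G.resolvent m a f)
  rcases eq_or_lt_of_le (norm_nonneg (G.resolvent m a f)) with h | h
  · rw [← h]; simp
  · nlinarith

theorem resolvent_sub (a b : ℝ) (ha : 0 < a) (hb : 0 < b) :
    G.resolvent m a - G.resolvent m b =
      (b - a) • (G.resolvent m a * G.resolvent m b) := by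
  ext1 f
  have h1 := G.isOperator_resolvent m hb f
  have h2 : f - b • G.resolvent m b f =
      (f - (b - a) • G.resolvent m b f) - a • G.resolvent m b f := by
    rw [sub_smul]; abel
  rw [h2] at h1
  have h3 := G.resolvent_unique m ha h1
  rw [map_sub, map_smul, sub_eq_iff_eq_add] at h3
  rw [sub_apply, smul_apply, mul_apply_eq_comp, h3]
  abel

theorem mem_regularDomain_of_finite_support {u : EllTwo m}
    (hu : (Function.support (fn u)).Finite) : u ∈ G.regularDomain m :=
  ⟨G.finiteEnergy_of_finite_support hu, fun ε hε => ⟨u, hu, by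
    rw [sub_self, formNorm, map_zero]
    simpa [energy] using hε⟩⟩

theorem delta_mem_regularDomain (x : V) : delta x ∈ G.regularDomain m := by
  classical
  refine G.mem_regularDomain_of_finite_support m ?_
  rw [fn_delta]
  exact (Set.finite_singleton x).subset (by classical exact Pi.support_single_subset)

theorem denseRange_resolvent : DenseRange (G.resolvent m 1) := by
  have h : (LinearMap.range (G.resolvent m 1).toLinearMap).topologicalClosure = ⊤ := by
    rw [Submodule.topologicalClosure_eq_top_iff, Submodule.eq_bot_iff]
    intro f hf
    have hf' : inner ℝ (G.resolvent m 1 f) f = 0 :=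
      (Submodule.mem_orthogonal _ _).1 hf _ ⟨f, rfl⟩
    obtain ⟨h1, h2⟩ := G.isOperator_resolvent m one_pos f
    have h3 := h2 _ h1
    have h4 := G.energy_self_nonneg (fn (G.resolvent m 1 f))
    rw [h3, inner_sub_left, real_inner_smul_left, real_inner_self_eq_norm_sq, real_inner_comm,
      hf'] at h4
    have h5 : G.resolvent m 1 f = 0 := by
      rw [← norm_eq_zero, ← sq_eq_zero_iff]
      nlinarith [sq_nonneg ‖G.resolvent m 1 f‖]
    rw [h5] at h2
    ext x
    have h6 := h2 _ (G.delta_mem_regularDomain m x)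
    have h7 : G.energy (fn (0 : EllTwo m)) (fn (delta x : EllTwo m)) = 0 := by
      simp [energy]
    classical
    rw [h7, smul_zero, sub_zero, EllTwo.inner_eq, tsum_eq_single x, fn_delta] at h6
    · have h8 : (m x : ℝ) ≠ 0 := ne_of_gt (m x).2
      have h9 : fn f x = 0 := by simpa [h8] using h6.symm
      exact h9
    · intro y hy
      rw [fn_delta, Pi.single_eq_of_ne hy]; simp
  intro f
  have : f ∈ (LinearMap.range (G.resolvent m 1).toLinearMap).topologicalClosure := by
    rw [h]; trivial
  exact this

/-! ### The semigroup and recurrence -/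

open Filter Topology

/-- The semigroup `e^{-tL}`, `t ≥ 0`, of the operator `L` associated with `Q^D_m`, as the strong
limit for `a → ∞` of the exponentials `exp (-t L_a)` of the bounded operators
`L_a = a L (L + a)⁻¹ = a (1 - a (L + a)⁻¹)`. The limit exists by `tendsto_semigroup`. -/
noncomputable def semigroup (t : ℝ) (f : EllTwo m) : EllTwo m :=
  limUnder atTop fun a : ℝ => NormedSpace.exp (-t • yosida (G.resolvent m) a) f

theorem tendsto_semigroup {t : ℝ} (ht : 0 ≤ t) (f : EllTwo m) :
    Tendsto (fun a : ℝ => NormedSpace.exp (-t • yosida (G.resolvent m) a) f) atTop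
      (𝓝 (G.semigroup m t f)) :=
  tendsto_nhds_limUnder (exists_yosida_limit (G.mul_norm_resolvent_le m) (G.resolvent_sub m)
    (G.denseRange_resolvent m) ht f)

/-- The Green function `G(x, y) = ∫₀^∞ e^{-tL} δ_x (y) dt ∈ [0, ∞]`. -/
noncomputable def greenFunction (x y : V) : ENNReal :=
  ∫⁻ t in Set.Ioi (0 : ℝ), ENNReal.ofReal (fn (G.semigroup m t (delta x)) y)

/-- The form `Q^D_m` is recurrent. -/
def IsRecurrent : Prop := ∀ x y, G.greenFunction m x y = ⊤

end WeightedGraph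

/-!
All six conditions are equivalent to the vanishing of capacities: for every vertex `o` and every
`ε > 0` there is a finitely supported `φ` with `φ o = 1` and `Q̃(φ) < ε` (`ZeroCapacity`). This
condition does not involve the measure `m`, nor the weight `v`.

*Recurrence.* The semigroup is a strong limit of exponentials of Yosida approximations, so its Laplace
transform is the resolvent (`laplace_yosida_limit`). Hence the Green function is an upper bound of the
resolvent kernels `g_a = (L + a)⁻¹ δ_x`, and at `(x, x)`, where the heat kernel is non-negative, it is
the limit of `g_a(x)` for `a → 0`. Since `Q(g_a) + a‖g_a‖² = m(x) g_a(x)`, the functions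
`g_a / g_a(x)` have energy at most `m(x) / g_a(x)`, so `x` has capacity zero if `g_a(x)` is unbounded
(`IsRecurrent.zeroCapacity`). Conversely, comparing `g_a` with multiples of functions `φ` of small
energy shows that `g_a(x)` is unbounded if `x` has capacity zero
(`ZeroCapacity.exists_le_fn_resolvent`). On a connected graph `(g_a(x) - g_a(y))²` is at most a
constant times `Q(g_a)`, hence of the order of `g_a(x)`, so that `g_a(y)` is unbounded as well
(`isRecurrent_of_zeroCapacity`).

*Uniqueness.* If capacities vanish, a solution `u` of finite energy of `(Δ̃ + v) u = 0` is tested with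
its truncation to `[-1, 1]` times a cut-off function of small energy, which gives `u = 0` for every
`v > 0` (`eq_zero_of_laplacian_add_eq_zero`). Conversely, let `v` be summable, so that
`1 ∈ ℓ²(V, v)`. Then `1 - (L + 1)⁻¹ 1` is a solution of finite energy. If it vanishes, then `1` is a
limit of finitely supported functions in the form norm, and as it has energy zero, capacities vanish
(`zeroCapacity_of_unique`).
-/

/-! ### Resolvents as Laplace transforms of semigroups -/

section

open Filter Topology MeasureTheory

variable {H : Type*} [NormedAddCommGroup H] [InnerProductSpace ℝ H]

/-- Strong convergence `a (L + a)⁻¹ → 1` as `a → ∞`. -/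
theorem tendsto_smul_resolvent {R : ℝ → H →L[ℝ] H} (hb : ∀ a, 0 < a → ∀ f, a * ‖R a f‖ ≤ ‖f‖)
    (hres : ∀ a b, 0 < a → 0 < b → R a - R b = (b - a) • (R a * R b))
    (hd : DenseRange (R 1)) (f : H) : Tendsto (fun a => (a • R a) f) atTop (𝓝 f) := by
  rw [Metric.tendsto_atTop]
  intro ε hε
  obtain ⟨_, hf', k, rfl⟩ := Metric.dense_iff.1 hd f (ε / 3) (by positivity)
  refine ⟨max 1 (3 * ‖R 1 k - k‖ / ε + 1), fun a ha => ?_⟩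
  have ha0 : 0 < a := by linarith [le_max_left 1 (3 * ‖R 1 k - k‖ / ε + 1)]
  have ha2 : 3 * ‖R 1 k - k‖ / ε < a := by linarith [le_max_right 1 (3 * ‖R 1 k - k‖ / ε + 1)]
  have e1 : (a • R a) (R 1 k) - R 1 k = R a (R 1 k - k) := by
    have := congrArg (fun T : H →L[ℝ] H => T k) (hres a 1 ha0 one_pos)
    simp only [sub_apply, smul_apply, mul_apply_eq_comp, sub_smul, one_smul] at this
    simp only [smul_apply, map_sub]
    rw [sub_eq_iff_eq_add] at this ⊢
    rw [this]; abel
  have e2 : ‖R a (R 1 k - k)‖ < ε / 3 := by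
    have := hb a ha0 (R 1 k - k)
    rw [div_lt_iff₀ hε] at ha2
    by_contra! hcon
    nlinarith
  have e3 : ‖f - R 1 k‖ < ε / 3 := by rw [← dist_eq_norm, dist_comm]; exact hf'
  have e4 : ‖(a • R a) (f - R 1 k)‖ ≤ ‖f - R 1 k‖ := by
    simpa [norm_smul, abs_of_pos ha0] using hb a ha0 (f - R 1 k)
  have : (a • R a) f - f = (a • R a) (f - R 1 k) + ((a • R a) (R 1 k) - R 1 k) - (f - R 1 k) := by
    rw [map_sub]; abel
  rw [dist_eq_norm, this, e1]
  calc _ ≤ ‖(a • R a) (f - R 1 k)‖ + ‖R a (R 1 k - k)‖ + ‖f - R 1 k‖ :=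
        (norm_sub_le _ _).trans (by gcongr; exact norm_add_le _ _)
    _ < ε := by linarith

/-- The Yosida approximations converge to the generator: on `R_b f = (L + b)⁻¹ f` the operator `L`
acts as `R_b f ↦ f - b R_b f`. -/
theorem tendsto_yosida_resolvent {R : ℝ → H →L[ℝ] H}
    (hb : ∀ a, 0 < a → ∀ f, a * ‖R a f‖ ≤ ‖f‖)
    (hres : ∀ a b, 0 < a → 0 < b → R a - R b = (b - a) • (R a * R b))
    (hd : DenseRange (R 1)) {b : ℝ} (hb0 : 0 < b) (f : H) :
    Tendsto (fun a => yosida R a (R b f)) atTop (𝓝 (f - b • R b f)) := by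
  refine (tendsto_smul_resolvent hb hres hd (f - b • R b f)).congr' ?_
  filter_upwards [eventually_gt_atTop 0] with a ha
  have := congrArg (fun T : H →L[ℝ] H => T f) (hres a b ha hb0)
  simp only [sub_apply, smul_apply, mul_apply_eq_comp, sub_smul] at this
  simp only [yosida, smul_apply, map_sub, map_smul, sub_apply, one_apply_eq_self]
  rw [sub_eq_iff_eq_add] at this
  rw [this]
  module

variable [CompleteSpace H]

theorem hasDerivAt_exp_neg_smul_apply (Y : H →L[ℝ] H) (h : H) (b t : ℝ) :
    HasDerivAt (fun t : ℝ => -(Real.exp (-b * t) • NormedSpace.exp (-t • Y) h))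
      (Real.exp (-b * t) • NormedSpace.exp (-t • Y) (Y h + b • h)) t := by
  have h1 : HasDerivAt (fun t : ℝ => NormedSpace.exp (-t • Y) h)
      (-(NormedSpace.exp (-t • Y) (Y h))) t := by
    have := (hasDerivAt_exp_smul_const (𝕂 := ℝ) (-Y) t).clm_apply (hasDerivAt_const t h)
    simpa only [smul_neg, ← neg_smul, mul_apply_eq_comp, neg_apply, map_neg, map_zero,
      add_zero] using this
  have h2 : HasDerivAt (fun t : ℝ => Real.exp (-b * t)) (Real.exp (-b * t) * (-b)) t := by
    simpa using ((hasDerivAt_id t).const_mul (-b)).exp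
  refine (h2.smul h1).neg.congr_deriv ?_
  rw [map_add, map_smul]
  module

/-- The strong limit `S_t = e^{-tL}` of the exponentials of the Yosida approximations has the
resolvent as its Laplace transform. For the bounded approximations `L_a`, integrating the derivative
of `t ↦ -e^{-bt} e^{-tL_a} h` with `h = R_b f` gives `h = ∫₀^∞ e^{-bt} e^{-tL_a} (L_a + b) h dt`;
since `(L_a + b) h → f`, dominated convergence yields the claim. -/
theorem laplace_yosida_limit {R : ℝ → H →L[ℝ] H}
    (hb : ∀ a, 0 < a → ∀ f, a * ‖R a f‖ ≤ ‖f‖)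
    (hres : ∀ a b, 0 < a → 0 < b → R a - R b = (b - a) • (R a * R b))
    (hd : DenseRange (R 1)) {S : ℝ → H} {f : H}
    (hS : ∀ t, 0 ≤ t → Tendsto (fun a => NormedSpace.exp (-t • yosida R a) f) atTop (𝓝 (S t)))
    {b : ℝ} (hb0 : 0 < b) :
    IntegrableOn (fun t => Real.exp (-b * t) • S t) (Set.Ioi 0) ∧
      ∫ t in Set.Ioi 0, Real.exp (-b * t) • S t = R b f := by
  let _ : NormedAlgebra ℚ (H →L[ℝ] H) := NormedAlgebra.restrictScalars ℚ ℝ _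
  set h := R b f with hh
  set F : ℝ → ℝ → H := fun a t =>
    Real.exp (-b * t) • NormedSpace.exp (-t • yosida R a) (yosida R a h + b • h) with hF
  have hcont : ∀ (Y : H →L[ℝ] H) (k : H),
      Continuous fun t : ℝ => Real.exp (-b * t) • NormedSpace.exp (-t • Y) k := fun Y k =>
    Continuous.smul (by fun_prop)
      ((NormedSpace.exp_continuous.comp (by fun_prop)).clm_apply continuous_const)
  have hexp : IntegrableOn (fun t => Real.exp (-b * t)) (Set.Ioi 0) :=
    exp_neg_integrableOn_Ioi 0 hb0
  have hFle : ∀ a, 0 < a → ∀ t ∈ Set.Ioi (0 : ℝ), ∀ k,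
      ‖Real.exp (-b * t) • NormedSpace.exp (-t • yosida R a) k‖ ≤ Real.exp (-b * t) * ‖k‖ := by
    intro a ha t ht k
    rw [norm_smul, Real.norm_eq_abs, Real.abs_exp]
    gcongr
    exact norm_exp_yosida_le hb ha (le_of_lt ht) _
  have hFint : ∀ a, 0 < a → ∀ k, IntegrableOn
      (fun t => Real.exp (-b * t) • NormedSpace.exp (-t • yosida R a) k) (Set.Ioi 0) := by
    intro a ha k
    refine (hexp.mul_const ‖k‖).mono' (hcont _ _).aestronglyMeasurable ?_
    filter_upwards [ae_restrict_mem measurableSet_Ioi] with t ht using hFle a ha t ht k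
  have hFval : ∀ a, 0 < a → ∫ t in Set.Ioi 0, F a t = h := by
    intro a ha
    have := integral_Ioi_of_hasDerivAt_of_tendsto (a := 0) (m := (0 : H))
      (f := fun t : ℝ => -(Real.exp (-b * t) • NormedSpace.exp (-t • yosida R a) h))
      (hcont _ _).neg.continuousWithinAt
      (fun t _ => hasDerivAt_exp_neg_smul_apply (yosida R a) h b t) (hFint a ha _) ?_
    · simpa only [hF, mul_zero, neg_zero, zero_smul, Real.exp_zero, NormedSpace.exp_zero, one_smul,
        one_apply_eq_self, sub_neg_eq_add, zero_add] using this
    · have h0 : Tendsto (fun t => Real.exp (-b * t) * ‖h‖) atTop (𝓝 0) := by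
        rw [← zero_mul ‖h‖]
        refine Tendsto.mul_const _ (Real.tendsto_exp_atBot.comp ?_)
        exact tendsto_id.const_mul_atTop_of_neg (by linarith)
      refine squeeze_zero_norm' ?_ h0
      filter_upwards [eventually_gt_atTop 0] with t ht
      rw [norm_neg]
      exact hFle a ha t ht h
  have hk : Tendsto (fun a => yosida R a h + b • h) atTop (𝓝 f) := by
    simpa only [← hh, sub_add_cancel] using
      (tendsto_yosida_resolvent hb hres hd hb0 f).add_const (b • h)
  have hFlim : ∀ t ∈ Set.Ioi (0 : ℝ),
      Tendsto (fun a => F a t) atTop (𝓝 (Real.exp (-b * t) • S t)) := by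
    intro t ht
    refine Tendsto.const_smul ?_ _
    have h1 : Tendsto (fun a => NormedSpace.exp (-t • yosida R a) (yosida R a h + b • h - f))
        atTop (𝓝 0) := by
      have h2 : Tendsto (fun a => ‖yosida R a h + b • h - f‖) atTop (𝓝 0) := by
        simpa using (hk.sub_const f).norm
      refine squeeze_zero_norm' ?_ h2
      filter_upwards [eventually_gt_atTop 0] with a ha
      exact norm_exp_yosida_le hb ha (le_of_lt ht) _
    simpa [← map_add] using h1.add (hS t (le_of_lt ht))
  have hbd : ∀ᶠ a in atTop, ∀ᵐ t ∂volume.restrict (Set.Ioi (0 : ℝ)),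
      ‖F a t‖ ≤ Real.exp (-b * t) * (‖f‖ + 1) := by
    filter_upwards [eventually_gt_atTop 0,
      hk.norm.eventually (eventually_le_nhds (lt_add_one ‖f‖))] with a ha hle
    filter_upwards [ae_restrict_mem measurableSet_Ioi] with t ht
    exact (hFle a ha t ht _).trans (by gcongr)
  have hlim : ∀ᵐ t ∂volume.restrict (Set.Ioi (0 : ℝ)),
      Tendsto (fun a => F a t) atTop (𝓝 (Real.exp (-b * t) • S t)) := by
    filter_upwards [ae_restrict_mem measurableSet_Ioi] with t ht using hFlim t ht
  have hmeas : ∀ a, AEStronglyMeasurable (F a) (volume.restrict (Set.Ioi (0 : ℝ))) :=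
    fun a => (hcont _ _).aestronglyMeasurable
  constructor
  · refine (hexp.mul_const (‖f‖ + 1)).mono' (aestronglyMeasurable_of_tendsto_ae atTop hmeas hlim) ?_
    -- the bound holds almost everywhere for each parameter, so a countable set of parameters is used
    have hcount : ∀ᶠ n : ℕ in atTop, ∀ᵐ t ∂volume.restrict (Set.Ioi (0 : ℝ)),
      ‖F n t‖ ≤ Real.exp (-b * t) * (‖f‖ + 1) := tendsto_natCast_atTop_atTop.eventually hbd
    obtain ⟨N, hN⟩ := eventually_atTop.1 hcount
    have hall : ∀ᵐ t ∂volume.restrict (Set.Ioi (0 : ℝ)), ∀ n : ℕ, N ≤ n →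
        ‖F n t‖ ≤ Real.exp (-b * t) * (‖f‖ + 1) := by
      rw [ae_all_iff]
      intro n
      by_cases hn : N ≤ n
      · filter_upwards [hN n hn] with t ht _ using ht
      · exact ae_of_all _ fun t h => absurd h hn
    filter_upwards [hall, hlim] with t h1 h2
    refine le_of_tendsto (h2.comp tendsto_natCast_atTop_atTop).norm ?_
    filter_upwards [eventually_ge_atTop N] with n hn using h1 n hn
  · refine tendsto_nhds_unique (tendsto_integral_filter_of_dominated_convergence
      (fun t => Real.exp (-b * t) * (‖f‖ + 1)) (.of_forall hmeas) hbd
      (hexp.mul_const _) hlim) ?_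
    refine tendsto_const_nhds.congr' ?_
    filter_upwards [eventually_gt_atTop 0] with a ha
    exact (hFval a ha).symm

/-- For self-adjoint resolvents the operators `e^{-tL}` are non-negative, being squares. -/
theorem inner_yosida_limit_nonneg {R : ℝ → H →L[ℝ] H}
    (hsymm : ∀ a, 0 < a → IsSelfAdjoint (R a)) {t : ℝ} {f g : H}
    (hS : Tendsto (fun a => NormedSpace.exp (-t • yosida R a) f) atTop (𝓝 g)) :
    0 ≤ (inner ℝ g f : ℝ) := by
  let _ : NormedAlgebra ℚ (H →L[ℝ] H) := NormedAlgebra.restrictScalars ℚ ℝ _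
  refine ge_of_tendsto (hS.inner tendsto_const_nhds) ?_
  filter_upwards [eventually_gt_atTop 0] with a ha
  set E := NormedSpace.exp ((-(t / 2)) • yosida R a) with hE
  have hY : IsSelfAdjoint ((-(t / 2)) • yosida R a) :=
    (IsSelfAdjoint.all (-(t / 2))).smul ((IsSelfAdjoint.all a).smul
      ((IsSelfAdjoint.one _).sub ((IsSelfAdjoint.all a).smul (hsymm a ha))))
  have hsq : NormedSpace.exp (-t • yosida R a) = E * E := by
    rw [hE, ← NormedSpace.exp_add_of_commute (Commute.refl _), ← add_smul]
    congr 2; ring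
  rw [hsq, mul_apply_eq_comp, ← ContinuousLinearMap.adjoint_inner_right,
    ← ContinuousLinearMap.star_eq_adjoint, hY.exp.star_eq]
  exact real_inner_self_nonneg

end

namespace WeightedGraph

open EllTwo

variable {V : Type*} (G : WeightedGraph V)

/-! ### The energy form -/

theorem energy_self_eq (u : V → ℝ) :
    G.energy u u = 1 / 2 * ∑' p : V × V, G.b p.1 p.2 * (u p.1 - u p.2) ^ 2 := by
  simp only [energy, sq]

/-- The energy decreases under normal contractions. -/
theorem energy_self_le_of_abs_sub_le {u w : V → ℝ} (hu : u ∈ G.finiteEnergy)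
    (h : ∀ x y, |w x - w y| ≤ |u x - u y|) :
    w ∈ G.finiteEnergy ∧ G.energy w w ≤ G.energy u u := by
  have hle : ∀ p : V × V, G.b p.1 p.2 * (w p.1 - w p.2) ^ 2 ≤ G.b p.1 p.2 * (u p.1 - u p.2) ^ 2 :=
    fun p => mul_le_mul_of_nonneg_left (sq_le_sq.2 (h _ _)) (G.nonneg _ _)
  have hw : w ∈ G.finiteEnergy :=
    Summable.of_nonneg_of_le (fun p => mul_nonneg (G.nonneg _ _) (sq_nonneg _)) hle hu
  refine ⟨hw, ?_⟩
  rw [energy_self_eq, energy_self_eq]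
  have := Summable.tsum_le_tsum hle hw hu
  linarith

open Classical in
/-- Green's formula for the function `δ_x`. -/
theorem energy_single {u : V → ℝ} (hu : u ∈ G.finiteEnergy) (o : V) :
    G.energy u (Pi.single o 1) = G.laplacian u o := by
  let f : V × V → ℝ := fun p => if p.1 = o then G.b p.1 p.2 * (u p.1 - u p.2) else 0
  have h1 : HasSum f (G.laplacian u o) := by
    refine (Function.Injective.hasSum_iff (g := fun y => (o, y))
      (fun _ _ h => (Prod.mk.inj h).2) ?_).1 ?_
    · rintro ⟨p, q⟩ hpq
      refine if_neg ?_
      rintro rfl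
      exact hpq ⟨q, rfl⟩
    · simpa [Function.comp_def, f, laplacian] using (G.summable_laplacian hu o).hasSum
  have h2 : HasSum (f ∘ Prod.swap) (G.laplacian u o) := (Equiv.prodComm V V).hasSum_iff.2 h1
  have h3 := (h1.add h2).tsum_eq
  rw [energy, show G.laplacian u o = 1 / 2 * (G.laplacian u o + G.laplacian u o) by ring, ← h3]
  congr 1
  refine tsum_congr fun p => ?_
  obtain ⟨p, q⟩ := p
  simp only [f, Function.comp_apply, Prod.swap_prod_mk, Pi.single_apply, G.symm q p]
  split_ifs <;> ring

/-- Green's formula for finitely supported test functions. -/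
theorem energy_eq_sum_laplacian {u φ : V → ℝ} (hu : u ∈ G.finiteEnergy)
    (hφ : (Function.support φ).Finite) :
    G.energy u φ = ∑ x ∈ hφ.toFinset, φ x * G.laplacian u x := by
  classical
  have hs : ∀ y, φ y = ∑ x ∈ hφ.toFinset, φ x * (Pi.single x (1 : ℝ) : V → ℝ) y := by
    intro y
    simp only [Pi.single_apply, mul_ite, mul_one, mul_zero]
    rw [Finset.sum_ite_eq]
    simp
  have hfin : ∀ x, Pi.single x (1 : ℝ) ∈ G.finiteEnergy := fun x =>
    G.finiteEnergy_of_finite_support ((Set.finite_singleton x).subset Pi.support_single_subset)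
  have hsum := Summable.tsum_finsetSum (s := hφ.toFinset)
    fun x _ => (G.summable_energy hu (hfin x)).mul_left (φ x)
  have hterm : ∀ x ∈ hφ.toFinset, φ x * G.laplacian u x = 1 / 2 * ∑' p : V × V,
      φ x * (G.b p.1 p.2 * ((u p.1 - u p.2) *
        ((Pi.single x (1 : ℝ) : V → ℝ) p.1 - (Pi.single x (1 : ℝ) : V → ℝ) p.2))) := fun x _ => by
    rw [← G.energy_single hu, energy, tsum_mul_left]
    ring
  rw [Finset.sum_congr rfl hterm, ← Finset.mul_sum, ← hsum, energy]
  refine congrArg _ (tsum_congr fun p => ?_)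
  conv_lhs => rw [hs p.1, hs p.2, ← Finset.sum_sub_distrib, Finset.mul_sum, Finset.mul_sum]
  exact Finset.sum_congr rfl fun x _ => by ring

theorem mul_sq_sub_le_energy {u : V → ℝ} (hu : u ∈ G.finiteEnergy) (x y : V) :
    G.b x y * (u x - u y) ^ 2 ≤ 2 * G.energy u u := by
  rw [energy_self_eq]
  have := hu.le_tsum (x, y) fun p _ => mul_nonneg (G.nonneg _ _) (sq_nonneg _)
  simp only at this
  linarith

/-- On a connected graph the differences of a function are controlled by its energy. -/
theorem Connected.exists_sq_sub_le (hG : G.Connected) (x y : V) :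
    ∃ C : ℝ, 0 < C ∧ ∀ u ∈ G.finiteEnergy, (u x - u y) ^ 2 ≤ C * G.energy u u := by
  induction hG x y with
  | refl => exact ⟨1, one_pos, fun u _ => by simpa using G.energy_self_nonneg u⟩
  | @tail z w _ hzw ih =>
    obtain ⟨C, hC, h⟩ := ih
    refine ⟨2 * (C + 2 / G.b z w), by positivity, fun u hu => ?_⟩
    have h1 := h u hu
    have h2 : (u z - u w) ^ 2 ≤ 2 / G.b z w * G.energy u u := by
      rw [div_mul_eq_mul_div, le_div_iff₀ hzw, mul_comm]
      exact G.mul_sq_sub_le_energy hu z w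
    nlinarith [sq_nonneg ((u x - u z) - (u z - u w))]

/-! ### Vertices of capacity zero -/

/-- The vertex `o` has capacity zero: the infimum of the energies of the finitely supported
functions with value `1` at `o` vanishes. -/
def ZeroCapacity (o : V) : Prop :=
  ∀ ε > 0, ∃ φ : V → ℝ, (Function.support φ).Finite ∧ φ o = 1 ∧ G.energy φ φ < ε

theorem abs_max_min_sub_max_min_le (a b s t : ℝ) :
    |max a (min s b) - max a (min t b)| ≤ |s - t| := by
  have h1 := abs_max_sub_max_le_max a (min s b) a (min t b)
  have h2 := abs_min_sub_min_le_max s b t b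
  simp only [sub_self, abs_zero] at h1 h2
  rw [max_eq_right (abs_nonneg (min s b - min t b))] at h1
  rw [max_eq_left (abs_nonneg (s - t))] at h2
  exact h1.trans h2

theorem ZeroCapacity.exists_mem_Icc {G : WeightedGraph V} {o : V} (h : G.ZeroCapacity o) {ε : ℝ}
    (hε : 0 < ε) : ∃ φ : V → ℝ, (Function.support φ).Finite ∧ φ o = 1 ∧ G.energy φ φ < ε ∧
      ∀ x, φ x ∈ Set.Icc (0 : ℝ) 1 := by
  obtain ⟨φ, h1, h2, h3⟩ := h ε hε
  refine ⟨fun x => max 0 (min (φ x) 1), h1.subset ?_, by simp [h2],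
    (G.energy_self_le_of_abs_sub_le (G.finiteEnergy_of_finite_support h1)
      fun x y => abs_max_min_sub_max_min_le 0 1 _ _).2.trans_lt h3,
    fun x => ⟨le_max_left _ _, max_le zero_le_one (min_le_right _ _)⟩⟩
  intro x hx h0
  exact hx (by simp [h0])

/-- In the definition of the capacity all functions in the domain of the regular form may be used
instead of those with finite support. -/
theorem exists_finite_support_energy_lt {m : V → Set.Ioi (0 : ℝ)} {g : EllTwo m}
    (hg : g ∈ G.regularDomain m) {o : V} (ho : fn g o ≠ 0) {ε : ℝ}
    (hε : G.energy (fn g) (fn g) / fn g o ^ 2 < ε) :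
    ∃ φ : V → ℝ, (Function.support φ).Finite ∧ φ o = 1 ∧ G.energy φ φ < ε := by
  obtain ⟨p, hp, rfl⟩ := G.exists_mem_of_mem_regularDomain m hg
  have c1 : Continuous fun p : WithLp 2 (EllTwo m × EdgeSpace V) => fn p.fst o :=
    (continuous_fn_apply o).comp (WithLp.fstL 2 ℝ (EllTwo m) (EdgeSpace V)).continuous
  have c2 : Continuous fun p : WithLp 2 (EllTwo m × EdgeSpace V) => ‖p.snd‖ ^ 2 :=
    ((WithLp.sndL 2 ℝ (EllTwo m) (EdgeSpace V)).continuous.norm).pow 2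
  have hE : ∀ q ∈ (G.gradGraph m).topologicalClosure,
      ‖q.snd‖ ^ 2 = G.energy (fn q.fst) (fn q.fst) := fun q hq => by
    rw [← real_inner_self_eq_norm_sq]
    exact G.inner_grad (G.snd_eq_grad_of_mem m hq) (G.snd_eq_grad_of_mem m hq)
  rw [← hE p hp] at hε
  have hev := ((c2.continuousAt (x := p)).div (c1.pow 2).continuousAt (pow_ne_zero 2 ho)).eventually
    (gt_mem_nhds hε)
  obtain ⟨q, hq, hlt, hq0⟩ := ((mem_closure_iff_frequently.1 hp).and_eventually
    (hev.and (c1.continuousAt.eventually_ne ho))).exists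
  simp only [Pi.div_apply, Pi.pow_apply] at hlt
  rw [hE q ((G.gradGraph m).le_topologicalClosure hq)] at hlt
  refine ⟨(fn q.fst o)⁻¹ • fn q.fst, hq.1.subset (Function.support_const_smul_subset _ _),
    by simp [hq0], ?_⟩
  refine lt_of_eq_of_lt ?_ hlt
  rw [energy_self_eq, energy_self_eq, mul_div_assoc, ← tsum_div_const]
  congr 2
  ext p
  simp only [Pi.smul_apply, smul_eq_mul]
  field_simp

/-! ### Capacity zero and uniqueness of solutions -/

/-- Young's inequality for the increments of a product: for increments `p` and `q` of the same sign,
the product `p (q s + c r)` is bounded below in terms of `p²` and `r²` alone. -/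
theorem neg_young_le_mul_add {p q r s c δ : ℝ} (hδ : 0 < δ) (hpq : 0 ≤ p * q) (hs : 0 ≤ s)
    (hc : |c| ≤ 1) : -(δ / 2 * p ^ 2 + 1 / (2 * δ) * r ^ 2) ≤ p * (q * s + c * r) := by
  have h1 : |p * c * r| ≤ |p| * |r| := by
    rw [abs_mul, abs_mul]
    exact mul_le_mul_of_nonneg_right (mul_le_of_le_one_right (abs_nonneg _) hc) (abs_nonneg _)
  have h2 : δ / 2 * p ^ 2 + 1 / (2 * δ) * r ^ 2 - |p| * |r| =
      1 / (2 * δ) * (δ * |p| - |r|) ^ 2 := by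
    rw [← sq_abs p, ← sq_abs r]
    field_simp
    ring
  have h3 : 0 ≤ 1 / (2 * δ) * (δ * |p| - |r|) ^ 2 := by positivity
  have h4 : p * (q * s + c * r) = p * q * s + p * c * r := by ring
  linarith [neg_abs_le (p * c * r), mul_nonneg hpq hs]

/-- A lower bound for `Q̃(u, w e)` if `u` and `w` vary in the same direction along each edge. -/
theorem neg_energy_le_energy_mul {u w e : V → ℝ} {δ : ℝ} (hδ : 0 < δ) (hu : u ∈ G.finiteEnergy)
    (he : e ∈ G.finiteEnergy) (hwe : (fun x => w x * e x) ∈ G.finiteEnergy)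
    (huw : ∀ x y, 0 ≤ (u x - u y) * (w x - w y)) (he0 : ∀ x, 0 ≤ e x) (hw : ∀ x, |w x| ≤ 1) :
    -(δ / 2 * G.energy u u + 1 / (2 * δ) * G.energy e e) ≤ G.energy u (fun x => w x * e x) := by
  have hus : Summable fun p : V × V => G.b p.1 p.2 * (u p.1 - u p.2) ^ 2 := hu
  have hes : Summable fun p : V × V => G.b p.1 p.2 * (e p.1 - e p.2) ^ 2 := he
  have hs := ((hus.mul_left (δ / 2)).add (hes.mul_left (1 / (2 * δ)))).neg
  have hle := hs.tsum_le_tsum (fun p => ?_) (G.summable_energy hu hwe)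
  · rw [tsum_neg, (hus.mul_left (δ / 2)).tsum_add (hes.mul_left (1 / (2 * δ))), tsum_mul_left,
      tsum_mul_left] at hle
    rw [energy_self_eq, energy_self_eq, energy]
    linarith
  · have h1 := neg_young_le_mul_add (r := e p.1 - e p.2) hδ (huw p.1 p.2) (he0 p.1) (hw p.2)
    have h2 := mul_le_mul_of_nonneg_left h1 (G.nonneg p.1 p.2)
    linarith

/-- If all capacities vanish, then `(Δ̃ + v) u = 0` has no non-trivial solution of finite energy.
The equation is tested with `φ = w e`, where `w` is the truncation of `u` to `[-1, 1]` and `e` is a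
cut-off function of small energy with `e o = 1`: on the one hand
`Q̃(u, φ) = -∑ v u w e ≤ -v(o) u(o) w(o)`, on the other hand `Q̃(u, φ)` is almost non-negative by
`neg_energy_le_energy_mul`, as `u` and `w` vary in the same direction along each edge. -/
theorem eq_zero_of_laplacian_add_eq_zero (h : ∀ o, G.ZeroCapacity o) {v : V → ℝ}
    (hv : ∀ x, 0 < v x) {u : V → ℝ} (hu : u ∈ G.finiteEnergy)
    (heq : ∀ x, G.laplacian u x + v x * u x = 0) : u = 0 := by
  classical
  funext o
  by_contra ho
  set w : V → ℝ := fun x => max (-1) (min (u x) 1) with hw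
  have hw1 : ∀ x, |w x| ≤ 1 := fun x =>
    abs_le.2 ⟨le_max_left _ _, max_le (by norm_num) (min_le_right _ _)⟩
  have huw : ∀ x, 0 ≤ u x * w x := by
    intro x
    rcases le_total 0 (u x) with h0 | h0
    · exact mul_nonneg h0 (le_max_of_le_right (le_min h0 zero_le_one))
    · exact mul_nonneg_of_nonpos_of_nonpos h0 (max_le (by norm_num) (min_le_of_left_le h0))
  have hmono : ∀ x y, 0 ≤ (u x - u y) * (w x - w y) := by
    intro x y
    have hw_mono : ∀ {x y}, u x ≤ u y → w x ≤ w y := fun hxy =>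
      max_le_max le_rfl (min_le_min hxy le_rfl)
    rcases le_total (u x) (u y) with hxy | hxy
    · exact mul_nonneg_of_nonpos_of_nonpos (by linarith) (by linarith [hw_mono hxy])
    · exact mul_nonneg (by linarith) (by linarith [hw_mono hxy])
  have hwo : w o ≠ 0 := by
    intro h0
    rcases lt_or_gt_of_ne ho with hlt | hlt
    · exact absurd h0 (max_lt (by norm_num) (min_lt_of_left_lt hlt)).ne
    · exact absurd h0 (lt_max_of_lt_right (lt_min hlt one_pos)).ne'
  clear_value w
  obtain ⟨c, hc⟩ : ∃ c, c = v o * (u o * w o) := ⟨_, rfl⟩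
  have hc0 : 0 < c := hc ▸ mul_pos (hv o) (lt_of_le_of_ne (huw o) (mul_ne_zero ho hwo).symm)
  have hE0 := G.energy_self_nonneg u
  -- the weight of Young's inequality below; with it both error terms stay below `c / 2`
  set δ := c / (G.energy u u + 1) with hδ
  have hδ0 : 0 < δ := by positivity
  clear_value δ
  obtain ⟨e, he1, he2, he3, he4⟩ := (h o).exists_mem_Icc (mul_pos hc0 hδ0)
  have heE := G.finiteEnergy_of_finite_support he1
  have hφ : (Function.support fun x => w x * e x).Finite :=
    he1.subset (Function.support_mul_subset_right _ _)
  have hφE := G.finiteEnergy_of_finite_support hφ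
  have hupper : G.energy u (fun x => w x * e x) ≤ -c := by
    rw [G.energy_eq_sum_laplacian hu hφ]
    have ho' : o ∈ hφ.toFinset := by simp [he2, hwo]
    rw [← Finset.add_sum_erase _ _ ho']
    have h1 : ∀ x, w x * e x * G.laplacian u x = -(e x * v x * (u x * w x)) := fun x => by
      rw [eq_neg_of_add_eq_zero_left (heq x)]; ring
    have h2 : ∑ x ∈ hφ.toFinset.erase o, w x * e x * G.laplacian u x ≤ 0 := by
      refine Finset.sum_nonpos fun x _ => ?_
      rw [h1, neg_nonpos]
      exact mul_nonneg (mul_nonneg (he4 x).1 (hv x).le) (huw x)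
    have h3 := h1 o
    rw [he2] at h3
    rw [he2, h3, hc]
    linarith
  have hlower := G.neg_energy_le_energy_mul hδ0 hu heE hφE hmono (fun x => (he4 x).1) hw1
  have h1 : δ / 2 * G.energy u u < c / 2 := by
    have : δ * (G.energy u u + 1) = c := by rw [hδ]; field_simp
    linarith
  have h2 : 1 / (2 * δ) * G.energy e e < c / 2 := by
    calc _ < 1 / (2 * δ) * (c * δ) := mul_lt_mul_of_pos_left he3 (by positivity)
      _ = c / 2 := by field_simp
  linarith

theorem existsUnique_laplacian_add_eq_zero_iff (v : V → ℝ) :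
    (∃! u : V → ℝ, u ∈ G.finiteEnergy ∧ ∀ x, G.laplacian u x + v x * u x = 0) ↔
      ∀ u ∈ G.finiteEnergy, (∀ x, G.laplacian u x + v x * u x = 0) → u = 0 := by
  have h0 : (0 : V → ℝ) ∈ G.finiteEnergy ∧ ∀ x, G.laplacian 0 x + v x * (0 : V → ℝ) x = 0 :=
    ⟨Submodule.zero_mem _, fun x => by simp [laplacian]⟩
  exact ⟨fun h u hu heq => h.unique ⟨hu, heq⟩ h0, fun h => ⟨0, h0, fun u hu => h u hu.1 hu.2⟩⟩

theorem finiteEnergy_one : (1 : V → ℝ) ∈ G.finiteEnergy := by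
  change Summable _
  simp

open Classical in
theorem inner_delta {m : V → Set.Ioi (0 : ℝ)} (f : EllTwo m) (x : V) :
    inner ℝ f (delta x) = (m x : ℝ) * fn f x := by
  rw [EllTwo.inner_eq, tsum_eq_single x, fn_delta]
  · simp
  · intro y hy
    rw [fn_delta, Pi.single_eq_of_ne hy]; simp

/-- If `v` is summable, then `1` minus its image under the resolvent `(L + 1)⁻¹` of `ℓ²(V, v)` is a
solution of `(Δ̃ + v) u = 0` of finite energy. If it vanishes, then `1` belongs to the domain of the
regular form, and since `1` has energy zero, all capacities vanish. -/
theorem zeroCapacity_of_unique {v : V → Set.Ioi (0 : ℝ)} (hv : Summable fun x => (v x : ℝ))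
    (h : ∀ u ∈ G.finiteEnergy, (∀ x, G.laplacian u x + (v x : ℝ) * u x = 0) → u = 0) (o : V) :
    G.ZeroCapacity o := by
  classical
  obtain ⟨f, hf⟩ := (exists_fn_eq_iff (m := v) 1).2 (by simpa using hv)
  obtain ⟨h1, h2⟩ := G.isOperator_resolvent v one_pos f
  set r := G.resolvent v 1 f
  have hr : fn r = 1 := by
    have hmem : 1 - fn r ∈ G.finiteEnergy := Submodule.sub_mem _ G.finiteEnergy_one h1.1
    have hl : G.laplacian (1 - fn r) = -G.laplacian (fn r) := by
      funext x
      simp only [laplacian, Pi.neg_apply, ← tsum_neg, Pi.sub_apply, Pi.one_apply]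
      exact tsum_congr fun y => by ring
    refine (sub_eq_zero.1 (h _ hmem fun x => ?_)).symm
    have h3 := h2 _ (G.delta_mem_regularDomain v x)
    rw [inner_delta, fn_delta, G.energy_single h1.1, one_smul, map_sub, hf] at h3
    rw [hl, Pi.neg_apply, h3]
    ring
  intro ε hε
  refine G.exists_finite_support_energy_lt h1 (o := o) (by simp [hr]) ?_
  simpa [hr, energy] using hε

/-! ### Capacity zero and recurrence -/

open Filter Topology MeasureTheory

variable (m : V → Set.Ioi (0 : ℝ))

theorem isSelfAdjoint_resolvent {a : ℝ} (ha : 0 < a) : IsSelfAdjoint (G.resolvent m a) := by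
  refine ContinuousLinearMap.isSelfAdjoint_iff_isSymmetric.2 fun f g => ?_
  obtain ⟨h1, h2⟩ := G.isOperator_resolvent m ha f
  obtain ⟨h3, h4⟩ := G.isOperator_resolvent m ha g
  have h5 := h2 _ h3
  have h6 := h4 _ h1
  rw [energy_comm, h6, inner_sub_left, inner_sub_left, real_inner_smul_left,
    real_inner_smul_left, real_inner_comm (G.resolvent m a f) g] at h5
  change inner ℝ (G.resolvent m a f) g = inner ℝ f (G.resolvent m a g)
  rw [real_inner_comm (G.resolvent m a f) (G.resolvent m a g)] at h5
  linarith

/-- The Laplace transform of the heat kernel is the resolvent kernel. -/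
theorem laplace_semigroup {a : ℝ} (ha : 0 < a) (x y : V) :
    IntegrableOn (fun t => Real.exp (-a * t) * fn (G.semigroup m t (delta x)) y) (Set.Ioi 0) ∧
      ∫ t in Set.Ioi 0, Real.exp (-a * t) * fn (G.semigroup m t (delta x)) y =
        fn (G.resolvent m a (delta x)) y := by
  obtain ⟨h1, h2⟩ := laplace_yosida_limit (G.mul_norm_resolvent_le m) (G.resolvent_sub m)
    (G.denseRange_resolvent m) (fun t ht => G.tendsto_semigroup m ht (delta x)) ha
  let ev : EllTwo m →L[ℝ] ℝ :=
    ⟨(LinearMap.proj y : (V → ℝ) →ₗ[ℝ] ℝ).comp fn, continuous_fn_apply y⟩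
  have h3 : ∀ t, ev (Real.exp (-a * t) • G.semigroup m t (delta x)) =
      Real.exp (-a * t) * fn (G.semigroup m t (delta x)) y := fun t => map_smul ev _ _
  constructor
  · exact (ev.integrable_comp h1).congr (ae_of_all _ h3)
  · rw [← integral_congr_ae (ae_of_all _ h3), ev.integral_comp_comm h1, h2]
    rfl

theorem fn_semigroup_self_nonneg {t : ℝ} (ht : 0 ≤ t) (x : V) :
    0 ≤ fn (G.semigroup m t (delta x)) x := by
  have h := inner_yosida_limit_nonneg (fun a ha => G.isSelfAdjoint_resolvent m ha)
    (G.tendsto_semigroup m ht (delta x))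
  rw [inner_delta] at h
  exact nonneg_of_mul_nonneg_right h (m x).2

theorem fn_resolvent_le_greenFunction {a : ℝ} (ha : 0 < a) (x y : V) :
    ENNReal.ofReal (fn (G.resolvent m a (delta x)) y) ≤ G.greenFunction m x y := by
  obtain ⟨h1, h2⟩ := G.laplace_semigroup m ha x y
  have hp := h1.pos_part
  have h3 : fn (G.resolvent m a (delta x)) y ≤
      ∫ t in Set.Ioi 0, max (Real.exp (-a * t) * fn (G.semigroup m t (delta x)) y) 0 :=
    h2 ▸ integral_mono h1 hp fun t => le_max_left _ _
  refine (ENNReal.ofReal_le_ofReal h3).trans ?_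
  rw [ofReal_integral_eq_lintegral_ofReal hp (ae_of_all _ fun t => le_max_right _ _)]
  refine setLIntegral_mono' measurableSet_Ioi fun t ht => ENNReal.ofReal_le_ofReal_iff'.2 ?_
  have hexp : Real.exp (-a * t) ≤ 1 := Real.exp_le_one_iff.2 (by nlinarith [Set.mem_Ioi.1 ht])
  rcases le_total 0 (fn (G.semigroup m t (delta x)) y) with h0 | h0
  · exact .inl (max_le (mul_le_of_le_one_left h0 hexp) h0)
  · exact .inr (max_le (mul_nonpos_of_nonneg_of_nonpos (Real.exp_nonneg _) h0) le_rfl)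

/-- If `G(o, o) = ∞`, then the resolvent kernels at `(o, o)` are unbounded as `a → 0`. Since the heat
kernel is non-negative on the diagonal, this is monotone convergence. -/
theorem exists_lt_fn_resolvent_of_greenFunction_eq_top {o : V} (h : G.greenFunction m o o = ⊤)
    (M : ℝ) : ∃ a, 0 < a ∧ M < fn (G.resolvent m a (delta o)) o := by
  by_contra! hcon
  have hle : ∀ n : ℕ, ∫⁻ t in Set.Ioi (0 : ℝ), ENNReal.ofReal
      (Real.exp (-(1 / ((n : ℝ) + 1)) * t) * fn (G.semigroup m t (delta o)) o) ≤
        ENNReal.ofReal M := by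
    intro n
    have hn : 0 < 1 / ((n : ℝ) + 1) := by positivity
    obtain ⟨h1, h2⟩ := G.laplace_semigroup m hn o o
    rw [← ofReal_integral_eq_lintegral_ofReal h1, h2]
    · exact ENNReal.ofReal_le_ofReal (hcon _ hn)
    · filter_upwards [ae_restrict_mem measurableSet_Ioi] with t ht
      exact mul_nonneg (Real.exp_nonneg _) (G.fn_semigroup_self_nonneg m (le_of_lt ht) o)
  have hfatou := lintegral_liminf_le' (u := atTop) fun n : ℕ =>
    (G.laplace_semigroup m (show 0 < 1 / ((n : ℝ) + 1) by positivity) o o).1.aemeasurable.ennreal_ofReal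
  have hlim : ∀ t : ℝ, liminf (fun n : ℕ => ENNReal.ofReal
      (Real.exp (-(1 / ((n : ℝ) + 1)) * t) * fn (G.semigroup m t (delta o)) o)) atTop =
        ENNReal.ofReal (fn (G.semigroup m t (delta o)) o) := by
    intro t
    refine Tendsto.liminf_eq (ENNReal.tendsto_ofReal ?_)
    have h0 : Tendsto (fun n : ℕ => Real.exp (-(1 / ((n : ℝ) + 1)) * t)) atTop (𝓝 1) := by
      have := (tendsto_one_div_add_atTop_nhds_zero_nat (𝕜 := ℝ)).neg.mul_const t
      simpa [Function.comp_def] using (Real.continuous_exp.tendsto _).comp this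
    simpa using h0.mul_const (fn (G.semigroup m t (delta o)) o)
  simp only [hlim] at hfatou
  rw [greenFunction] at h
  rw [h, top_le_iff] at hfatou
  have := Filter.liminf_le_of_frequently_le' (Frequently.of_forall (f := atTop) hle)
  rw [hfatou, top_le_iff] at this
  exact ENNReal.ofReal_ne_top this

theorem energy_resolvent_le {a : ℝ} (ha : 0 < a) (o : V) :
    G.energy (fn (G.resolvent m a (delta o))) (fn (G.resolvent m a (delta o))) ≤
      (m o : ℝ) * fn (G.resolvent m a (delta o)) o := by
  obtain ⟨h1, h2⟩ := G.isOperator_resolvent m ha (delta o)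
  rw [h2 _ h1, inner_sub_left, real_inner_smul_left, real_inner_comm, inner_delta]
  have := mul_nonneg ha.le (real_inner_self_nonneg (x := G.resolvent m a (delta o)))
  linarith

theorem IsRecurrent.zeroCapacity {m} (h : G.IsRecurrent m) (o : V) : G.ZeroCapacity o := by
  intro ε hε
  have hm : (0 : ℝ) < m o := (m o).2
  obtain ⟨a, ha, hlt⟩ :=
    G.exists_lt_fn_resolvent_of_greenFunction_eq_top m (h o o) ((m o : ℝ) / ε)
  have hpos : 0 < fn (G.resolvent m a (delta o)) o := lt_trans (by positivity) hlt
  refine G.exists_finite_support_energy_lt (G.isOperator_resolvent m ha (delta o)).1 hpos.ne' ?_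
  rw [div_lt_iff₀ (by positivity)]
  rw [div_lt_iff₀ hε] at hlt
  nlinarith [G.energy_resolvent_le m ha o]

/-- If `o` has capacity zero, then the resolvent kernels at `(o, o)` are unbounded as `a → 0`: the
form `Q + a‖·‖²` of `g - M φ` is non-negative, where `g = (L + a)⁻¹ δ_o` and `φ` is a finitely
supported function with `φ(o) = 1`; the energy of `φ` and then `a` are chosen small. -/
theorem ZeroCapacity.exists_le_fn_resolvent {o : V} (h : G.ZeroCapacity o) {M : ℝ} (hM : 0 < M) :
    ∃ a, 0 < a ∧ M ≤ fn (G.resolvent m a (delta o)) o := by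
  have hm : (0 : ℝ) < m o := (m o).2
  obtain ⟨φ, h1, h2, h3⟩ := h (m o / (2 * M)) (by positivity)
  obtain ⟨f, rfl⟩ := (exists_fn_eq_iff (m := m) φ).2 (summable_of_hasFiniteSupport
    (h1.subset fun x hx h0 => hx (by simp [h0])))
  set a := (m o : ℝ) / (2 * M) / (‖f‖ ^ 2 + 1) with hadef
  have ha : 0 < a := by positivity
  refine ⟨a, ha, ?_⟩
  have hfE := G.finiteEnergy_of_finite_support h1
  have hfR := G.mem_regularDomain_of_finite_support m h1
  obtain ⟨h4, h5⟩ := G.isOperator_resolvent m ha (delta o)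
  set g := G.resolvent m a (delta o)
  have hMf : M • fn f ∈ G.finiteEnergy := Submodule.smul_mem _ _ hfE
  have hsmul : ∀ u v : V → ℝ, G.energy (M • u) v = M * G.energy u v := by
    intro u v
    rw [energy, energy, mul_left_comm, ← tsum_mul_left (a := M)]
    congr 2; ext p
    simp only [Pi.smul_apply, smul_eq_mul]; ring
  have hE : 0 ≤ G.energy (fn g - M • fn f) (fn g - M • fn f) := G.energy_self_nonneg _
  have hD := Submodule.sub_mem _ h4.1 hMf
  have e1 := h5 _ h4
  have e2 := h5 _ hfR
  rw [G.energy_sub_left h4.1 hMf hD, hsmul, G.energy_comm _ (fn g - M • fn f),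
    G.energy_comm (fn f), G.energy_sub_left h4.1 hMf h4.1, G.energy_sub_left h4.1 hMf hfE, hsmul,
    hsmul, G.energy_comm (fn f) (fn g), e1, e2, inner_sub_left, inner_sub_left,
    real_inner_smul_left, real_inner_smul_left, real_inner_comm _ (delta o),
    real_inner_comm _ (delta o), inner_delta, inner_delta, h2] at hE
  have hN : 0 ≤ ‖g - M • f‖ ^ 2 := sq_nonneg _
  rw [← real_inner_self_eq_norm_sq, inner_sub_left, inner_sub_right, inner_sub_right,
    real_inner_smul_left, real_inner_smul_left, real_inner_smul_right, real_inner_smul_right,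
    real_inner_comm g f, real_inner_self_eq_norm_sq f] at hN
  have hN' := mul_nonneg ha.le hN
  have haf : a * ‖f‖ ^ 2 ≤ (m o : ℝ) / (2 * M) := by
    have : a * (‖f‖ ^ 2 + 1) = (m o : ℝ) / (2 * M) := by rw [hadef]; field_simp
    linarith
  have hsum : M ^ 2 * (G.energy (fn f) (fn f) + a * ‖f‖ ^ 2) ≤ M * m o := by
    calc _ ≤ M ^ 2 * ((m o : ℝ) / (2 * M) + (m o : ℝ) / (2 * M)) := by gcongr
      _ = M * m o := by field_simp; ring
  have : 0 ≤ (m o : ℝ) * (fn g o - M) := by nlinarith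
  linarith [nonneg_of_mul_nonneg_right this hm]

/-- If all capacities vanish, the resolvent kernels `g = (L + a)⁻¹ δ_x` tend to infinity at `x` as
`a → 0`, hence at every vertex, as `(g(x) - g(y))² ≤ C Q(g) ≤ C m(x) g(x)` on a connected graph. -/
theorem isRecurrent_of_zeroCapacity (hG : G.Connected) (h : ∀ o, G.ZeroCapacity o) :
    G.IsRecurrent m := by
  intro x y
  refine ENNReal.eq_top_of_forall_nnreal_le fun M => ?_
  have hm : (0 : ℝ) < m x := (m x).2
  obtain ⟨C, hC, hCle⟩ := hG.exists_sq_sub_le G x y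
  have hM0 : (0 : ℝ) ≤ M := M.2
  -- the bound is large enough that `g y < M` would force `g x - g y ≥ g x / 2`, hence `g x ≤ 4 C m(x)`
  obtain ⟨a, ha, hge⟩ := (h x).exists_le_fn_resolvent G m
    (M := 2 * M + 5 * C * m x) (by positivity)
  refine le_trans ?_ (G.fn_resolvent_le_greenFunction m ha x y)
  rw [← ENNReal.ofReal_coe_nnreal]
  refine ENNReal.ofReal_le_ofReal ?_
  have h1 := hCle _ (G.isOperator_resolvent m ha (delta x)).1.1
  have h2 := mul_le_mul_of_nonneg_left (G.energy_resolvent_le m ha x) hC.le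
  generalize fn (G.resolvent m a (delta x)) = g at *
  by_contra! hlt
  have h3 : 0 < g x := lt_of_lt_of_le (by positivity) hge
  have h4 : g x / 2 ≤ g x - g y := by nlinarith [mul_pos hC hm]
  have h5 : (g x / 2) ^ 2 ≤ (g x - g y) ^ 2 := by gcongr
  have h6 : g x * g x ≤ g x * (4 * (C * m x)) := by nlinarith
  have h7 := le_of_mul_le_mul_left h6 h3
  nlinarith [mul_pos hC hm]

theorem exists_summable_measure (V : Type*) [Countable V] :
    ∃ m : V → Set.Ioi (0 : ℝ), Summable fun x => (m x : ℝ) := by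
  have := Encodable.ofCountable V
  obtain ⟨ε, hε, c, hc, -⟩ := posSumOfEncodable one_pos V
  exact ⟨fun x => ⟨ε x, hε x⟩, hc.summable⟩

theorem formalLaplacian_add_eq_zero_iff {a : ℝ} (u : V → ℝ) (x : V) :
    G.formalLaplacian m u x + a * u x = 0 ↔ G.laplacian u x + a * m x * u x = 0 := by
  have hm : (m x : ℝ) ≠ 0 := ne_of_gt (m x).2
  rw [formalLaplacian, laplacian, ← mul_right_inj' hm, mul_zero]
  field_simp

end WeightedGraph

theorem mainTheorem5 {V : Type*} [Infinite V] [Countable V] (G : WeightedGraph V)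
    (hG : G.Connected) :
    List.TFAE
      [∃ m : V → Set.Ioi (0 : ℝ), G.IsRecurrent m,
       ∀ m : V → Set.Ioi (0 : ℝ), G.IsRecurrent m,
       ∀ m : V → Set.Ioi (0 : ℝ), ∀ α : ℝ, 0 < α →
         ∃! u : V → ℝ, u ∈ G.finiteEnergy ∧ ∀ x, G.formalLaplacian m u x + α * u x = 0,
       ∃ m : V → Set.Ioi (0 : ℝ), (Summable fun x => (m x : ℝ)) ∧ ∀ α : ℝ, 0 < α →
         ∃! u : V → ℝ, u ∈ G.finiteEnergy ∧ ∀ x, G.formalLaplacian m u x + α * u x = 0,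
       ∀ v : V → Set.Ioi (0 : ℝ),
         ∃! u : V → ℝ, u ∈ G.finiteEnergy ∧ ∀ x, G.laplacian u x + (v x : ℝ) * u x = 0,
       ∃ v : V → Set.Ioi (0 : ℝ), (Summable fun x => (v x : ℝ)) ∧
         ∃! u : V → ℝ, u ∈ G.finiteEnergy ∧ ∀ x, G.laplacian u x + (v x : ℝ) * u x = 0] := by
  simp only [G.formalLaplacian_add_eq_zero_iff, G.existsUnique_laplacian_add_eq_zero_iff]
  obtain ⟨m₀, hm₀⟩ := WeightedGraph.exists_summable_measure V
  tfae_have 2 → 1 := fun h => ⟨m₀, h m₀⟩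
  tfae_have 1 → 5 := fun ⟨_, h⟩ v _ hu heq =>
    G.eq_zero_of_laplacian_add_eq_zero h.zeroCapacity (fun x => (v x).2) hu heq
  tfae_have 5 → 3 := fun h m α hα => h fun x => ⟨α * m x, mul_pos hα (m x).2⟩
  tfae_have 3 → 4 := fun h => ⟨m₀, hm₀, h m₀⟩
  tfae_have 4 → 6 := fun ⟨m, hm, h⟩ => ⟨m, hm, by simpa using h 1 one_pos⟩
  tfae_have 6 → 2 := fun ⟨v, hv, h⟩ m =>
    G.isRecurrent_of_zeroCapacity m hG (G.zeroCapacity_of_unique hv h)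
  tfae_finish
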